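/- Let $n\ge 1$ be an integer. Let $\mu$ be the probability measure $d\mu(t)=\frac{dt}{\pi\sqrt{t(1-t)}}$ on $(0,1)$, and put $d\nu_1(t)=t^{-1}d\mu(t)$, $d\nu_2(t)=(1-t)^{-1}d\mu(t)$. Let $L_2^c(\nu_1;\ell_2^n)$ and $L_2^r(\nu_2;\ell_2^n)$ be the complex Hilbert spaces $L_2(\nu_1;\ell_2^n)$ and $L_2(\nu_2;\ell_2^n)$ with the column and the row operator space structure, respectively. Let $\oplus_1$ be the $\ell_1$-direct sum of operator spaces, that is, $E\oplus_1F$ carries the structure given by its canonical inclusion in $(E^*\oplus_\infty F^*)^*$. Let $G_n=\big(L_2^c(\nu_1;\ell_2^n)\oplus_1L_2^r(\nu_2;\ell_2^n)\big)/\ker Q$ be the operator space quotient by the kernel of the map $Q(f,g)(t)=f(t)+g(t)$ into the space $L_0(\mu;\ell_2^n)$ of $\mu$-a.e. classes of measurable $\ell_2^n$-valued functions. With the unit vectors $e_1,\dots,e_n$ of $\ell_2^n$, let $f_k\in G_n$ be the class of $(\sqrt t\,e_k,(1-\sqrt t)\,e_k)$ for $1\le k\le n$. Let $G_n\stackrel{\wedge}{\otimes}G_n$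 be the operator space projective tensor product, whose norm is determined by $(E\stackrel{\wedge}{\otimes}F)^*=CB(E,F^*)$ isometrically. Then for every complex $n\times n$ matrix $[a_{ij}]$ \[ \Big\|\sum_{i,j=1}^n a_{ij}\,f_i\otimes f_j\Big\|_{G_n\stackrel{\wedge}{\otimes}G_n}\le 16\,\sqrt{1+\ln n}\,\Big(\sum_{i,j=1}^n|a_{ij}|^2\Big)^{1/2}, \] and moreover \[ \Big\|\sum_{i=1}^n f_i\otimes f_i\Big\|_{G_n\stackrel{\wedge}{\otimes}G_n}\ge \frac{1}{8\pi}\sqrt{n(1+\ln n)}. \] -/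

import Mathlib

open MeasureTheory
open scoped TensorProduct

namespace OHProj

section OperatorSpaces

open scoped Matrix.Norms.L2Operator

/-! ### Operator space structures

Complex scalar matrices carry the operator norm between Euclidean spaces. An operator space
structure on `V` is given by its norms on all the matrix spaces `M_m(V)`. -/

/-- A family of functions on the matrix spaces `M_m(V)`, `m = 0, 1, 2, …`; all the families used
below are the concrete operator space norms defined in this file. -/
abbrev MatrixNorms (V : Type*) := (m : ℕ) → Matrix (Fin m) (Fin m) V → ℝ

/-- The column Hilbert space `H^c`: `‖x‖² = ‖x* x‖ = ‖[∑ₖ (x_{ki}, x_{kj})]_{ij}‖`. The inner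
product is antilinear in its first argument. -/
noncomputable def columnNorms (H : Type*) [NormedAddCommGroup H] [InnerProductSpace ℂ H] :
    MatrixNorms H := fun m x =>
  √‖(Matrix.of fun i j => ∑ k, inner ℂ (x k i) (x k j) : Matrix (Fin m) (Fin m) ℂ)‖

/-- The row Hilbert space `H^r`: `‖x‖² = ‖x x*‖ = ‖[∑ₖ (x_{ik}, x_{jk})]_{ij}‖`. -/
noncomputable def rowNorms (H : Type*) [NormedAddCommGroup H] [InnerProductSpace ℂ H] :
    MatrixNorms H := fun m x =>
  √‖(Matrix.of fun i j => ∑ k, inner ℂ (x i k) (x j k) : Matrix (Fin m) (Fin m) ℂ)‖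

variable {V W : Type*} [AddCommGroup V] [Module ℂ V] [AddCommGroup W] [Module ℂ W]

/-- `u : V → M_k` is a complete contraction: `‖[u(x_{ij})]‖_{M_m(M_k)} ≤ ‖x‖_{M_m(V)}` for all
`m` and all `x`. These maps form the unit ball of `M_k(V*) = CB(V, M_k)`. -/
def IsCompleteContraction (N : MatrixNorms V) {k : ℕ}
    (u : V →ₗ[ℂ] Matrix (Fin k) (Fin k) ℂ) : Prop :=
  ∀ (m : ℕ) (x : Matrix (Fin m) (Fin m) V),
    ‖(Matrix.of fun a b => u (x a.1 b.1) a.2 b.2 :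
      Matrix (Fin m × Fin k) (Fin m × Fin k) ℂ)‖ ≤ N m x

/-- The set of numbers `‖[u(x_{ij}) + v(y_{ij})]‖`, where `x_{ij}` and `y_{ij}` are the two
components of `z_{ij}` and `(u, v)` runs through the unit balls of `M_k(V* ⊕_∞ W*)`, `k ∈ ℕ`. -/
def l1SumSet (N : MatrixNorms V) (N' : MatrixNorms W) (m : ℕ)
    (z : Matrix (Fin m) (Fin m) (V × W)) : Set ℝ :=
  {r | ∃ (k : ℕ) (u : V →ₗ[ℂ] Matrix (Fin k) (Fin k) ℂ) (v : W →ₗ[ℂ] Matrix (Fin k) (Fin k) ℂ),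
    IsCompleteContraction N u ∧ IsCompleteContraction N' v ∧
    r = ‖(Matrix.of fun a b => u (z a.1 b.1).1 a.2 b.2 + v (z a.1 b.1).2 a.2 b.2 :
      Matrix (Fin m × Fin k) (Fin m × Fin k) ℂ)‖}

/-- The operator space `V ⊕₁ W`, defined by its canonical inclusion in `(V* ⊕_∞ W*)*`. -/
noncomputable def l1SumNorms (N : MatrixNorms V) (N' : MatrixNorms W) : MatrixNorms (V × W) :=
  fun m z => sSup (l1SumSet N N' m z)

/-- The set whose supremum defines the norm of `V ⊕₁ W` is bounded. -/
theorem bddAbove_l1SumSet (N : MatrixNorms V) (N' : MatrixNorms W) (m : ℕ)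
    (z : Matrix (Fin m) (Fin m) (V × W)) : BddAbove (l1SumSet N N' m z) := by
  refine ⟨N m (z.map Prod.fst) + N' m (z.map Prod.snd), ?_⟩
  rintro r ⟨k, u, v, hu, hv, rfl⟩
  exact (norm_add_le
    (Matrix.of fun a b => u (z a.1 b.1).1 a.2 b.2 : Matrix (Fin m × Fin k) (Fin m × Fin k) ℂ)
    (Matrix.of fun a b => v (z a.1 b.1).2 a.2 b.2)).trans
      (add_le_add (hu m (z.map Prod.fst)) (hv m (z.map Prod.snd)))

/-- The operator space quotient: `M_m(V/S) = M_m(V)/M_m(S)` with its quotient norm. -/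
noncomputable def quotientNorms (N : MatrixNorms V) (S : Submodule ℂ V) : MatrixNorms (V ⧸ S) :=
  fun m x => sInf {r | ∃ y : Matrix (Fin m) (Fin m) V, y.map S.mkQ = x ∧ r = N m y}

/-- `B : V → W*` is a complete contraction, for the dual operator space structure
`M_q(W*) = CB(W, M_q)`: `‖[B(x_{ij}, y_{kl})]‖_{M_{pq}} ≤ ‖x‖_{M_p(V)} ‖y‖_{M_q(W)}` for all
`x ∈ M_p(V)`, `y ∈ M_q(W)`. -/
def IsJointCompleteContraction (N : MatrixNorms V) (N' : MatrixNorms W)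
    (B : V →ₗ[ℂ] W →ₗ[ℂ] ℂ) : Prop :=
  ∀ (p q : ℕ) (x : Matrix (Fin p) (Fin p) V) (y : Matrix (Fin q) (Fin q) W),
    ‖(Matrix.of fun a b => B (x a.1 b.1) (y a.2 b.2) :
      Matrix (Fin p × Fin q) (Fin p × Fin q) ℂ)‖ ≤ N p x * N' q y

/-- The set of numbers `|⟨B, w⟩|`, where `B` runs through the unit ball of `CB(V, W*)`. -/
def projectiveSet (N : MatrixNorms V) (N' : MatrixNorms W) (w : V ⊗[ℂ] W) : Set ℝ :=
  {r | ∃ B : V →ₗ[ℂ] W →ₗ[ℂ] ℂ, IsJointCompleteContraction N N' B ∧ r = ‖TensorProduct.lift B w‖}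

/-- The operator space projective tensor norm on the algebraic tensor product: the norm for which
the dual of (the completion of) `V ⊗ W` is `CB(V, W*)` isometrically. -/
noncomputable def projectiveNorm (N : MatrixNorms V) (N' : MatrixNorms W) (w : V ⊗[ℂ] W) : ℝ :=
  sSup (projectiveSet N N' w)

/-- The set whose supremum defines the projective tensor norm is bounded. -/
theorem bddAbove_projectiveSet (N : MatrixNorms V) (N' : MatrixNorms W) (w : V ⊗[ℂ] W) :
    BddAbove (projectiveSet N N' w) := by
  induction w using TensorProduct.induction_on with
  | zero => exact ⟨0, by rintro r ⟨B, -, rfl⟩; simp⟩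
  | tmul x y =>
    refine ⟨N 1 (Matrix.of fun _ _ => x) * N' 1 (Matrix.of fun _ _ => y), ?_⟩
    rintro r ⟨B, hB, rfl⟩
    refine le_trans (le_of_eq ?_) (hB 1 1 (Matrix.of fun _ _ => x) (Matrix.of fun _ _ => y))
    have h : (Matrix.of fun a b => B ((Matrix.of fun _ _ => x : Matrix (Fin 1) (Fin 1) V) a.1 b.1)
          ((Matrix.of fun _ _ => y : Matrix (Fin 1) (Fin 1) W) a.2 b.2) :
        Matrix (Fin 1 × Fin 1) (Fin 1 × Fin 1) ℂ) = Matrix.diagonal fun _ => B x y := by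
      ext a b
      simp [Subsingleton.elim a b]
    rw [h, Matrix.l2_opNorm_diagonal]
    simp
  | add w₁ w₂ h₁ h₂ =>
    obtain ⟨c₁, hc₁⟩ := h₁
    obtain ⟨c₂, hc₂⟩ := h₂
    refine ⟨c₁ + c₂, ?_⟩
    rintro r ⟨B, hB, rfl⟩
    rw [map_add]
    exact (norm_add_le _ _).trans (add_le_add (hc₁ ⟨B, hB, rfl⟩) (hc₂ ⟨B, hB, rfl⟩))

end OperatorSpaces

section Measures

/-- The probability measure `dμ(t) = dt / (π √(t(1-t)))` on `(0,1)`. -/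
noncomputable def μ : Measure ℝ :=
  (volume.restrict (Set.Ioo 0 1)).withDensity
    fun t => ENNReal.ofReal (1 / (Real.pi * √(t * (1 - t))))

/-- `dν₁(t) = t⁻¹ dμ(t)`. -/
noncomputable def ν₁ : Measure ℝ := μ.withDensity fun t => ENNReal.ofReal t⁻¹

/-- `dν₂(t) = (1-t)⁻¹ dμ(t)`. -/
noncomputable def ν₂ : Measure ℝ := μ.withDensity fun t => ENNReal.ofReal (1 - t)⁻¹

theorem ae_mem_Ioo : ∀ᵐ t ∂μ, t ∈ Set.Ioo (0 : ℝ) 1 :=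
  (withDensity_absolutelyContinuous _ _).ae_le (ae_restrict_mem measurableSet_Ioo)

theorem μ_ac_ν₁ : μ ≪ ν₁ := by
  refine withDensity_absolutelyContinuous' (by fun_prop) ?_
  filter_upwards [ae_mem_Ioo] with t ht
  simpa using ht.1

theorem μ_ac_ν₂ : μ ≪ ν₂ := by
  refine withDensity_absolutelyContinuous' (by fun_prop) ?_
  filter_upwards [ae_mem_Ioo] with t ht
  simpa using ht.2

theorem μ_univ_lt_top : μ Set.univ < ⊤ := by
  have h1 : IntegrableOn (fun t : ℝ => t ^ (-(1 / 2) : ℝ)) (Set.Ioo 0 1) volume := by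
    have := (intervalIntegral.intervalIntegrable_rpow' (a := 0) (b := 1)
      (r := (-(1 / 2) : ℝ)) (by norm_num))
    rwa [intervalIntegrable_iff_integrableOn_Ioo_of_le zero_le_one] at this
  have h2 : IntegrableOn (fun t : ℝ => (1 - t) ^ (-(1 / 2) : ℝ)) (Set.Ioo 0 1) volume := by
    have := ((intervalIntegral.intervalIntegrable_rpow' (a := 0) (b := 1)
      (r := (-(1 / 2) : ℝ)) (by norm_num)).comp_sub_left 1).symm
    simp only [sub_zero, sub_self] at this
    rwa [intervalIntegrable_iff_integrableOn_Ioo_of_le zero_le_one] at this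
  have h3 := (h1.add h2).lintegral_lt_top
  rw [μ, withDensity_apply _ MeasurableSet.univ, Measure.restrict_univ]
  refine lt_of_le_of_lt (setLIntegral_mono' measurableSet_Ioo fun t ht => ?_) h3
  refine ENNReal.ofReal_le_ofReal ?_
  have ht0 : 0 < t := ht.1
  have ht1 : 0 < 1 - t := sub_pos.2 ht.2
  have hs : 0 < √t := Real.sqrt_pos.2 ht0
  have hs' : 0 < √(1 - t) := Real.sqrt_pos.2 ht1
  have e1 := Real.sq_sqrt ht0.le
  have e2 := Real.sq_sqrt ht1.le
  simp only [Pi.add_apply]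
  rw [Real.rpow_neg ht0.le, Real.rpow_neg ht1.le, ← Real.sqrt_eq_rpow, ← Real.sqrt_eq_rpow,
    Real.sqrt_mul ht0.le]
  have hsum : 1 ≤ √t + √(1 - t) := by nlinarith [mul_pos hs hs']
  have hpi : 1 ≤ Real.pi := by linarith [Real.pi_gt_three]
  have : (√t)⁻¹ + (√(1 - t))⁻¹ = (√t + √(1 - t)) / (√t * √(1 - t)) := by
    field_simp
    ring
  rw [this]
  have hp : 0 < √t * √(1 - t) := mul_pos hs hs'
  rw [one_div]
  calc (Real.pi * (√t * √(1 - t)))⁻¹ ≤ (√t * √(1 - t))⁻¹ :=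
        inv_anti₀ hp (le_mul_of_one_le_left hp.le hpi)
    _ = 1 / (√t * √(1 - t)) := (one_div _).symm
    _ ≤ _ := by gcongr

end Measures

section SpaceG

/-- `L₂(ν; ℓ₂ⁿ)`. -/
noncomputable abbrev L2 (ν : Measure ℝ) (n : ℕ) := Lp (EuclideanSpace ℂ (Fin n)) 2 ν

/-- The inclusion of `L₂(ν; ℓ₂ⁿ)` into the space `L⁰(μ; ℓ₂ⁿ)` of `μ`-classes of measurable
functions, for `μ ≪ ν`. -/
noncomputable def toL0 (n : ℕ) {ν : Measure ℝ} (h : μ ≪ ν) :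
    L2 ν n →ₗ[ℂ] (ℝ →ₘ[μ] EuclideanSpace ℂ (Fin n)) where
  toFun f := AEEqFun.mk f ((Lp.aestronglyMeasurable f).mono_ac h)
  map_add' f g := by
    rw [AEEqFun.mk_add_mk]
    exact AEEqFun.mk_eq_mk.2 (h.ae_eq (Lp.coeFn_add f g))
  map_smul' c f :=
    (AEEqFun.mk_eq_mk.2 (h.ae_eq (Lp.coeFn_smul c f))).trans
      (AEEqFun.smul_mk c _ ((Lp.aestronglyMeasurable f).mono_ac h))

/-- The map `Q(f, g)(t) = f(t) + g(t)` from `L₂(ν₁; ℓ₂ⁿ) ⊕ L₂(ν₂; ℓ₂ⁿ)` to `L⁰(μ; ℓ₂ⁿ)`. -/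
noncomputable def Q (n : ℕ) : (L2 ν₁ n × L2 ν₂ n) →ₗ[ℂ] (ℝ →ₘ[μ] EuclideanSpace ℂ (Fin n)) :=
  (toL0 n μ_ac_ν₁).coprod (toL0 n μ_ac_ν₂)

/-- The vector space `G_n = (L₂(ν₁; ℓ₂ⁿ) ⊕ L₂(ν₂; ℓ₂ⁿ)) / ker Q`. -/
abbrev G (n : ℕ) := (L2 ν₁ n × L2 ν₂ n) ⧸ LinearMap.ker (Q n)

/-- The operator space structure of `G_n = (L₂^c(ν₁; ℓ₂ⁿ) ⊕₁ L₂^r(ν₂; ℓ₂ⁿ)) / ker Q`. -/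
noncomputable def normsG (n : ℕ) : MatrixNorms (G n) :=
  quotientNorms (l1SumNorms (columnNorms (L2 ν₁ n)) (rowNorms (L2 ν₂ n))) (LinearMap.ker (Q n))

theorem memLp_sqrt (n : ℕ) (k : Fin n) :
    MemLp (fun t : ℝ => ((√t : ℝ) : ℂ) • EuclideanSpace.single k (1 : ℂ)) 2 ν₁ := by
  refine ⟨by fun_prop, ?_⟩
  rw [eLpNorm_lt_top_iff_lintegral_rpow_enorm_lt_top (by norm_num) (by norm_num)]
  rw [ν₁, lintegral_withDensity_eq_lintegral_mul₀ (by fun_prop) (by fun_prop)]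
  refine lt_of_le_of_lt (lintegral_mono_ae (g := fun _ => 1) ?_) (by simpa using μ_univ_lt_top)
  filter_upwards [ae_mem_Ioo] with t ht
  rw [Pi.mul_apply, ← ofReal_norm, norm_smul, Complex.norm_real, ENNReal.toReal_ofNat,
    ENNReal.ofReal_rpow_of_nonneg (by positivity) (by norm_num),
    ← ENNReal.ofReal_mul (inv_nonneg.2 ht.1.le)]
  refine ENNReal.ofReal_le_one.2 ?_
  simp [abs_of_nonneg, Real.sqrt_nonneg, Real.sq_sqrt ht.1.le, ht.1.ne']

theorem memLp_one_sub_sqrt (n : ℕ) (k : Fin n) :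
    MemLp (fun t : ℝ => ((1 - √t : ℝ) : ℂ) • EuclideanSpace.single k (1 : ℂ)) 2 ν₂ := by
  refine ⟨by fun_prop, ?_⟩
  rw [eLpNorm_lt_top_iff_lintegral_rpow_enorm_lt_top (by norm_num) (by norm_num)]
  rw [ν₂, lintegral_withDensity_eq_lintegral_mul₀ (by fun_prop) (by fun_prop)]
  refine lt_of_le_of_lt (lintegral_mono_ae (g := fun _ => 1) ?_) (by simpa using μ_univ_lt_top)
  filter_upwards [ae_mem_Ioo] with t ht
  have ht1 : 0 < 1 - t := sub_pos.2 ht.2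
  rw [Pi.mul_apply, ← ofReal_norm, norm_smul, Complex.norm_real, ENNReal.toReal_ofNat,
    ENNReal.ofReal_rpow_of_nonneg (by positivity) (by norm_num),
    ← ENNReal.ofReal_mul (inv_nonneg.2 ht1.le)]
  refine ENNReal.ofReal_le_one.2 ?_
  have h1 : √t ≤ 1 := Real.sqrt_le_one.2 ht.2.le
  have h2 := Real.sq_sqrt ht.1.le
  have h0 := Real.sqrt_nonneg t
  have : (1 - √t) ^ 2 ≤ 1 - t := by nlinarith
  simpa [inv_mul_le_iff₀ ht1] using this

/-- The canonical vectors `f_k = (√t e_k, (1-√t) e_k) + ker Q` of `G_n`; `Q` maps their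
representatives to the constant functions `e_k`. -/
noncomputable def f (n : ℕ) (k : Fin n) : G n :=
  (LinearMap.ker (Q n)).mkQ ((memLp_sqrt n k).toLp _, (memLp_one_sub_sqrt n k).toLp _)

end SpaceG

end OHProj

/-!
By definition the projective norm of `∑ a_{ij} f_i ⊗ f_j` is the supremum of
`|∑ a_{ij} B(f_i, f_j)|` over the jointly completely contractive forms `B` on `G_n`. Such a form
has four blocks, according to the column and row summands. A form on `H^c × K^c` or `H^r × K^r` is
jointly completely contractive when its Hilbert–Schmidt norm is at most one, a form on `H^c × K^r`
or `H^r × K^c` when its norm is at most one (`norm_sum_le_of_column_column`,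
`isJointCompleteContraction_column_column`, `isJointCompleteContraction_column_row`,
`IsJointCompleteContraction.norm_le_of_row_column`). The blocks determine each other, since a
function that lies in both `L₂(ν₁)` and `L₂(ν₂)` may be placed in either summand of `G_n`
(`columnIncl_indVec`).

Upper bound. As `Q f_k` is the constant function `e_k`, one may cut the interval at `1/2`, use the
row summand on the left half and the column summand on the right half, and cut each half into
`M ≈ 1 + ln n` dyadic pieces `L_m` and `1 - L_m` of distance `4^{-m}` to the end point, together
with a remainder at the scale `1/n`. If both vectors live on the same half, the Hilbert–Schmidt
bound is enough. On opposite halves, a pair `(L_m, 1 - L_{m'})` is estimated by the column–column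
block if `m ≤ m'` and by the row–row block otherwise. The squares of the resulting weights sum to
`O(M)` (`sum_mul_ν₁_real_le`), because `∫∫ ds dt / (√s √t (s + t))` diverges logarithmically at
the origin. The pair of the two remainders is controlled by the bounded mixed block at the cost of
a factor `√n`, which the measure `O(n^{-1/2})` of the remainder absorbs (`norm_sum_last_cell_le`).

Lower bound. The extremal form has the kernel `(n ln n)^{-1/2} / (s + (1 - t))` times the identity
of `ℓ₂ⁿ`, truncated at the scale `1/n`. Its discretization `dyadicForm` is diagonal with respect
to integrals over disjoint dyadic intervals, which form weighted Bessel sequences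
(`sum_norm_sq_integralCoord_le`), so the norms of its four blocks can be read off
(`isJointCompleteContraction_dyadicForm`).
-/

namespace OHProj

/-! ### Operator norms of matrices and the column Hilbert space -/

section MatrixNorm

open scoped Matrix.Norms.L2Operator

variable {ι κ : Type*} [Fintype ι] [Fintype κ] [DecidableEq κ]

theorem norm_bilin_le (A : Matrix ι κ ℂ) (η : ι → ℂ) (ξ : κ → ℂ) :
    ‖∑ i, ∑ j, η i * A i j * ξ j‖ ≤ ‖A‖ * √(∑ i, ‖η i‖ ^ 2) * √(∑ j, ‖ξ j‖ ^ 2) := by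
  have h1 := A.l2_opNorm_mulVec (WithLp.toLp 2 ξ)
  have h2 := norm_inner_le_norm (𝕜 := ℂ) (WithLp.toLp 2 (star η) : EuclideanSpace ℂ ι)
    (WithLp.toLp 2 (A.mulVec ξ))
  have e1 : inner ℂ (WithLp.toLp 2 (star η) : EuclideanSpace ℂ ι)
      (WithLp.toLp 2 (A.mulVec ξ)) = ∑ i, ∑ j, η i * A i j * ξ j := by
    simp [PiLp.inner_apply, Matrix.mulVec, dotProduct, Finset.mul_sum, mul_comm, mul_left_comm]
  rw [e1] at h2
  have e2 : ‖(WithLp.toLp 2 (star η) : EuclideanSpace ℂ ι)‖ = √(∑ i, ‖η i‖ ^ 2) := by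
    simp [EuclideanSpace.norm_eq]
  have e3 : ‖(WithLp.toLp 2 ξ : EuclideanSpace ℂ κ)‖ = √(∑ i, ‖ξ i‖ ^ 2) := by
    simp [EuclideanSpace.norm_eq]
  rw [e2] at h2
  rw [e3] at h1
  calc _ ≤ _ := h2
    _ ≤ √(∑ i, ‖η i‖ ^ 2) * (‖A‖ * √(∑ i, ‖ξ i‖ ^ 2)) := by gcongr; exact h1
    _ = _ := by ring

/-- The operator norm is the norm of the associated bilinear form. -/
theorem l2_opNorm_le_of_bilin (A : Matrix ι κ ℂ) {C : ℝ} (hC : 0 ≤ C)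
    (h : ∀ (η : ι → ℂ) (ξ : κ → ℂ), ‖∑ i, ∑ j, η i * A i j * ξ j‖ ≤
      C * √(∑ i, ‖η i‖ ^ 2) * √(∑ j, ‖ξ j‖ ^ 2)) : ‖A‖ ≤ C := by
  rw [Matrix.l2_opNorm_def]
  refine ContinuousLinearMap.opNorm_le_bound _ hC fun x => ?_
  have h1 := h (star (A.mulVec x.ofLp)) x.ofLp
  set v : EuclideanSpace ℂ ι := WithLp.toLp 2 (A.mulVec x.ofLp) with hv
  change ‖v‖ ≤ _
  have e1 : ∑ i, ∑ j, star (A.mulVec x.ofLp) i * A i j * x.ofLp j = ((‖v‖ ^ 2 : ℝ) : ℂ) := by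
    rw [EuclideanSpace.norm_sq_eq]
    push_cast
    refine Finset.sum_congr rfl fun i _ => ?_
    simp only [mul_assoc]
    rw [← Finset.mul_sum]
    change star (A.mulVec x.ofLp i) * (A.mulVec x.ofLp i) = _
    exact RCLike.conj_mul (A.mulVec x.ofLp i)
  have e2 : √(∑ i, ‖star (A.mulVec x.ofLp) i‖ ^ 2) = ‖v‖ := by
    simp [EuclideanSpace.norm_eq, v]
  have e3 : √(∑ i, ‖x.ofLp i‖ ^ 2) = ‖x‖ := by
    simp [EuclideanSpace.norm_eq]
  rw [e1, e2, e3, Complex.norm_real, Real.norm_of_nonneg (by positivity)] at h1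
  rcases eq_or_lt_of_le (norm_nonneg v) with h0 | h0
  · rw [← h0]; positivity
  · have : ‖v‖ * ‖v‖ ≤ (C * ‖x‖) * ‖v‖ := by nlinarith
    exact le_of_mul_le_mul_right this h0

theorem l2_opNorm_submatrix_le {ι' κ' : Type*} [Fintype ι'] [Fintype κ']
    [DecidableEq κ'] (A : Matrix ι κ ℂ) (e : ι' ≃ ι) (g : κ' ≃ κ) : ‖A.submatrix e g‖ ≤ ‖A‖ := by
  refine l2_opNorm_le_of_bilin _ (norm_nonneg _) fun η ξ => ?_
  have := norm_bilin_le A (η ∘ e.symm) (ξ ∘ g.symm)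
  rw [← e.sum_comp (fun i => ∑ j, (η ∘ e.symm) i * A i j * (ξ ∘ g.symm) j),
    ← e.sum_comp (fun i => ‖(η ∘ e.symm) i‖ ^ 2), ← g.sum_comp (fun i => ‖(ξ ∘ g.symm) i‖ ^ 2)]
    at this
  simp_rw [← g.sum_comp (fun j => _ * A _ j * (ξ ∘ g.symm) j)] at this
  simpa using this

theorem l2_opNorm_submatrix (A : Matrix κ κ ℂ) {ι' : Type*} [Fintype ι'] [DecidableEq ι']
    (e : ι' ≃ κ) : ‖A.submatrix e e‖ = ‖A‖ := by
  refine le_antisymm (l2_opNorm_submatrix_le A e e) ?_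
  simpa using l2_opNorm_submatrix_le (A.submatrix e e) e.symm e.symm

theorem l2_opNorm_transpose_le [DecidableEq ι] (A : Matrix ι κ ℂ) : ‖A.transpose‖ ≤ ‖A‖ := by
  refine l2_opNorm_le_of_bilin _ (norm_nonneg _) fun η ξ => ?_
  have := norm_bilin_le A ξ η
  rw [Finset.sum_comm] at this
  simp only [Matrix.transpose_apply]
  calc _ = _ := by
        congr 1
        exact Finset.sum_congr rfl fun i _ => Finset.sum_congr rfl fun j _ =>
          (by ring : _ = ξ j * A j i * η i)
    _ ≤ _ := this
    _ = _ := by ring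

theorem l2_opNorm_transpose [DecidableEq ι] (A : Matrix ι κ ℂ) : ‖A.transpose‖ = ‖A‖ :=
  le_antisymm (l2_opNorm_transpose_le A) (l2_opNorm_transpose_le A.transpose)

end MatrixNorm

section HilbertSpaces

open scoped Matrix.Norms.L2Operator

variable {H K : Type*} [NormedAddCommGroup H] [InnerProductSpace ℂ H]
  [NormedAddCommGroup K] [InnerProductSpace ℂ K]

theorem columnNorms_nonneg (m : ℕ) (x : Matrix (Fin m) (Fin m) H) : 0 ≤ columnNorms H m x :=
  Real.sqrt_nonneg _

theorem rowNorms_nonneg (m : ℕ) (x : Matrix (Fin m) (Fin m) H) : 0 ≤ rowNorms H m x :=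
  Real.sqrt_nonneg _

/-- A column matrix acts as an operator from `ℓ₂ᵐ` to `H ⊗ ℓ₂ᵐ` of norm at most `‖x‖`. -/
theorem sum_norm_sq_sum_smul_le (m : ℕ) (x : Matrix (Fin m) (Fin m) H) (ξ : Fin m → ℂ) :
    ∑ i, ‖∑ j, ξ j • x i j‖ ^ 2 ≤ columnNorms H m x ^ 2 * ∑ j, ‖ξ j‖ ^ 2 := by
  have h := norm_bilin_le (Matrix.of fun i j => ∑ k, inner ℂ (x k i) (x k j) :
    Matrix (Fin m) (Fin m) ℂ) (star ξ) ξ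
  have e : ∑ i, ∑ j, star ξ i * (Matrix.of fun i j => ∑ k, inner ℂ (x k i) (x k j) :
      Matrix (Fin m) (Fin m) ℂ) i j * ξ j = ((∑ i, ‖∑ j, ξ j • x i j‖ ^ 2 : ℝ) : ℂ) := by
    push_cast
    have (k : Fin m) : (‖∑ j, ξ j • x k j‖ : ℂ) ^ 2 =
        ∑ i, ∑ j, star ξ i * inner ℂ (x k i) (x k j) * ξ j := by
      refine (inner_self_eq_norm_sq_to_K (𝕜 := ℂ) (∑ j, ξ j • x k j)).symm.trans ?_
      rw [sum_inner]
      refine Finset.sum_congr rfl fun i _ => ?_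
      rw [inner_sum]
      refine Finset.sum_congr rfl fun j _ => ?_
      rw [inner_smul_left, inner_smul_right]
      simp only [Pi.star_apply, RCLike.star_def]
      ring
    simp_rw [this]
    refine Eq.trans ?_ Finset.sum_comm
    refine Finset.sum_congr rfl fun i _ => ?_
    refine Eq.trans ?_ Finset.sum_comm
    refine Finset.sum_congr rfl fun j _ => ?_
    simp only [Matrix.of_apply, Finset.mul_sum, Finset.sum_mul]
  rw [e, Complex.norm_real, Real.norm_of_nonneg (by positivity)] at h
  refine h.trans (le_of_eq ?_)
  simp only [Pi.star_apply, norm_star]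
  rw [columnNorms, Real.sq_sqrt (norm_nonneg _), mul_assoc, Real.mul_self_sqrt (by positivity)]

end HilbertSpaces

/-! ### Jointly completely contractive forms on Hilbert spaces -/

section JointComplete

open scoped Matrix.Norms.L2Operator

section General

variable {V W : Type*} [AddCommGroup V] [Module ℂ V] [AddCommGroup W] [Module ℂ W]

/-- The matrix `[B(x_{ij}, y_{kl})]`. -/
def pairingMatrix (B : V →ₗ[ℂ] W →ₗ[ℂ] ℂ) {p q : ℕ} (x : Matrix (Fin p) (Fin p) V)
    (y : Matrix (Fin q) (Fin q) W) : Matrix (Fin p × Fin q) (Fin p × Fin q) ℂ :=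
  Matrix.of fun a b => B (x a.1 b.1) (y a.2 b.2)

theorem norm_pairingMatrix_flip (B : V →ₗ[ℂ] W →ₗ[ℂ] ℂ) {p q : ℕ} (x : Matrix (Fin p) (Fin p) V)
    (y : Matrix (Fin q) (Fin q) W) : ‖pairingMatrix B.flip y x‖ = ‖pairingMatrix B x y‖ :=
  l2_opNorm_submatrix (pairingMatrix B x y) (Equiv.prodComm _ _)

theorem norm_pairingMatrix_transpose (B : V →ₗ[ℂ] W →ₗ[ℂ] ℂ) {p q : ℕ}
    (x : Matrix (Fin p) (Fin p) V) (y : Matrix (Fin q) (Fin q) W) :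
    ‖pairingMatrix B x.transpose y.transpose‖ = ‖pairingMatrix B x y‖ :=
  l2_opNorm_transpose (pairingMatrix B x y)

theorem IsJointCompleteContraction.flip {N : MatrixNorms V} {N' : MatrixNorms W}
    {B : V →ₗ[ℂ] W →ₗ[ℂ] ℂ} (hB : IsJointCompleteContraction N N' B) :
    IsJointCompleteContraction N' N B.flip := fun p q x y =>
  (norm_pairingMatrix_flip B y x).trans_le ((hB q p y x).trans_eq (mul_comm _ _))

/-- To bound `[B(x_{ij}, y_{kl})]`, one contracts the first matrix with the vector on the right. -/
theorem norm_pairingMatrix_le (B : V →ₗ[ℂ] W →ₗ[ℂ] ℂ) {p q : ℕ} (x : Matrix (Fin p) (Fin p) V)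
    (y : Matrix (Fin q) (Fin q) W) {C : ℝ} (hC : 0 ≤ C)
    (h : ∀ η ξ : Fin p × Fin q → ℂ,
      ‖∑ i, ∑ k, η (i, k) * ∑ l, B (∑ j, ξ (j, l) • x i j) (y k l)‖ ≤
        C * √(∑ a, ‖η a‖ ^ 2) * √(∑ b, ‖ξ b‖ ^ 2)) : ‖pairingMatrix B x y‖ ≤ C := by
  refine l2_opNorm_le_of_bilin _ hC fun η ξ => le_trans (le_of_eq ?_) (h η ξ)
  congr 1
  rw [Fintype.sum_prod_type]
  refine Finset.sum_congr rfl fun i _ => Finset.sum_congr rfl fun k _ => ?_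
  rw [Fintype.sum_prod_type_right, Finset.mul_sum]
  refine Finset.sum_congr rfl fun l _ => ?_
  rw [map_sum, LinearMap.sum_apply, Finset.mul_sum]
  refine Finset.sum_congr rfl fun j _ => ?_
  simp only [pairingMatrix, Matrix.of_apply, map_smul, LinearMap.smul_apply, smul_eq_mul]
  ring

end General

variable {H K : Type*} [NormedAddCommGroup H] [InnerProductSpace ℂ H]
  [NormedAddCommGroup K] [InnerProductSpace ℂ K]

theorem isJointCompleteContraction_row_row_iff {B : H →ₗ[ℂ] K →ₗ[ℂ] ℂ} :
    IsJointCompleteContraction (rowNorms H) (rowNorms K) B ↔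
      IsJointCompleteContraction (columnNorms H) (columnNorms K) B :=
  ⟨fun h p q x y => (norm_pairingMatrix_transpose B x y).symm.trans_le
      (h p q x.transpose y.transpose),
    fun h p q x y => (norm_pairingMatrix_transpose B x y).symm.trans_le
      (h p q x.transpose y.transpose)⟩

theorem isJointCompleteContraction_row_column_iff {B : H →ₗ[ℂ] K →ₗ[ℂ] ℂ} :
    IsJointCompleteContraction (rowNorms H) (columnNorms K) B ↔
      IsJointCompleteContraction (columnNorms H) (rowNorms K) B :=
  ⟨fun h p q x y => (norm_pairingMatrix_transpose B x y).symm.trans_le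
      (h p q x.transpose y.transpose),
    fun h p q x y => (norm_pairingMatrix_transpose B x y).symm.trans_le
      (h p q x.transpose y.transpose)⟩

/-- `CB(H^c, (K^r)*) = B(H, K*)`: every contractive bilinear form on `H^c × K^r` is jointly
completely contractive. -/
theorem isJointCompleteContraction_column_row {B : H →ₗ[ℂ] K →ₗ[ℂ] ℂ}
    (hB : ∀ x y, ‖B x y‖ ≤ ‖x‖ * ‖y‖) :
    IsJointCompleteContraction (columnNorms H) (rowNorms K) B := by
  intro p q x y
  have hx0 := columnNorms_nonneg p x
  have hy0 := rowNorms_nonneg q y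
  refine norm_pairingMatrix_le B x y (mul_nonneg hx0 hy0) fun η ξ => ?_
  set X : Fin p × Fin q → H := fun a => ∑ j, ξ (j, a.2) • x a.1 j with hX
  set Y : Fin p × Fin q → K := fun a => ∑ k, η (a.1, k) • y k a.2 with hY
  have e : ∑ i, ∑ k, η (i, k) * ∑ l, B (∑ j, ξ (j, l) • x i j) (y k l) = ∑ a, B (X a) (Y a) := by
    rw [Fintype.sum_prod_type]
    refine Finset.sum_congr rfl fun i _ => ?_
    simp only [Finset.mul_sum, hX, hY, map_sum, map_smul, smul_eq_mul]
    rw [Finset.sum_comm]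
  have hXs : ∑ a, ‖X a‖ ^ 2 ≤ columnNorms H p x ^ 2 * ∑ b, ‖ξ b‖ ^ 2 := by
    rw [Fintype.sum_prod_type_right, Fintype.sum_prod_type_right, Finset.mul_sum]
    exact Finset.sum_le_sum fun l _ => sum_norm_sq_sum_smul_le p x fun j => ξ (j, l)
  have hYs : ∑ a, ‖Y a‖ ^ 2 ≤ rowNorms K q y ^ 2 * ∑ b, ‖η b‖ ^ 2 := by
    rw [Fintype.sum_prod_type, Fintype.sum_prod_type, Finset.mul_sum]
    exact Finset.sum_le_sum fun i _ => sum_norm_sq_sum_smul_le q y.transpose fun k => η (i, k)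
  calc _ = ‖∑ a, B (X a) (Y a)‖ := by rw [e]
    _ ≤ ∑ a, ‖X a‖ * ‖Y a‖ := (norm_sum_le _ _).trans (Finset.sum_le_sum fun a _ => hB _ _)
    _ ≤ √(∑ a, ‖X a‖ ^ 2) * √(∑ a, ‖Y a‖ ^ 2) := Real.sum_mul_le_sqrt_mul_sqrt _ _ _
    _ ≤ √(columnNorms H p x ^ 2 * ∑ b, ‖ξ b‖ ^ 2) * √(rowNorms K q y ^ 2 * ∑ b, ‖η b‖ ^ 2) := by
        gcongr
    _ = _ := by
        rw [Real.sqrt_mul (sq_nonneg _), Real.sqrt_mul (sq_nonneg _), Real.sqrt_sq hx0,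
          Real.sqrt_sq hy0]
        ring

/-- `CB(H^c, (K^c)*)` contains the Hilbert–Schmidt forms: a form that is diagonal, with
coefficients in the unit ball of `ℓ₂`, with respect to two Bessel sequences of functionals is
jointly completely contractive on `H^c × K^c`. Of the second sequence it is only needed that its
members are contractive. -/
theorem isJointCompleteContraction_column_column {γ : Type*} [Fintype γ] (φ : γ → H →ₗ[ℂ] ℂ)
    (ψ : γ → K →ₗ[ℂ] ℂ) (c : γ → ℂ) (hφ : ∀ x, ∑ g, ‖φ g x‖ ^ 2 ≤ ‖x‖ ^ 2)
    (hψ : ∀ g y, ‖ψ g y‖ ≤ ‖y‖) (hc : ∑ g, ‖c g‖ ^ 2 ≤ 1) {B : H →ₗ[ℂ] K →ₗ[ℂ] ℂ}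
    (hB : ∀ x y, B x y = ∑ g, c g * φ g x * ψ g y) :
    IsJointCompleteContraction (columnNorms H) (columnNorms K) B := by
  intro p q x y
  have hx0 := columnNorms_nonneg p x
  have hy0 := columnNorms_nonneg q y
  refine norm_pairingMatrix_le B x y (mul_nonneg hx0 hy0) fun η ξ => ?_
  set X : Fin p → Fin q → H := fun i l => ∑ j, ξ (j, l) • x i j with hX
  set Z : γ × (Fin p × Fin q) → K := fun a => ∑ l, φ a.1 (X a.2.1 l) • y a.2.2 l with hZ
  have e : ∑ i, ∑ k, η (i, k) * ∑ l, B (X i l) (y k l) =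
      ∑ a : γ × (Fin p × Fin q), (c a.1 * η a.2) * ψ a.1 (Z a) := by
    rw [Fintype.sum_prod_type_right, Fintype.sum_prod_type]
    refine Finset.sum_congr rfl fun i _ => Finset.sum_congr rfl fun k _ => ?_
    simp only [hB, hZ, Finset.mul_sum, map_sum, map_smul, smul_eq_mul]
    rw [Finset.sum_comm]
    exact Finset.sum_congr rfl fun g _ => Finset.sum_congr rfl fun l _ => by ring
  have hXs : ∑ i, ∑ l, ‖X i l‖ ^ 2 ≤ columnNorms H p x ^ 2 * ∑ b, ‖ξ b‖ ^ 2 := by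
    rw [Fintype.sum_prod_type_right, Finset.mul_sum, Finset.sum_comm]
    exact Finset.sum_le_sum fun l _ => sum_norm_sq_sum_smul_le p x fun j => ξ (j, l)
  have hZs : ∑ a, ‖ψ a.1 (Z a)‖ ^ 2 ≤
      columnNorms K q y ^ 2 * (columnNorms H p x ^ 2 * ∑ b, ‖ξ b‖ ^ 2) := by
    calc _ ≤ ∑ a, ‖Z a‖ ^ 2 := Finset.sum_le_sum fun a _ => by gcongr; exact hψ _ _
      _ = ∑ g, ∑ i, ∑ k, ‖∑ l, φ g (X i l) • y k l‖ ^ 2 := by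
          rw [Fintype.sum_prod_type]
          exact Finset.sum_congr rfl fun g _ => Fintype.sum_prod_type _
      _ ≤ ∑ g, ∑ i, columnNorms K q y ^ 2 * ∑ l, ‖φ g (X i l)‖ ^ 2 :=
          Finset.sum_le_sum fun g _ => Finset.sum_le_sum fun i _ =>
            sum_norm_sq_sum_smul_le q y fun l => φ g (X i l)
      _ = columnNorms K q y ^ 2 * ∑ i, ∑ l, ∑ g, ‖φ g (X i l)‖ ^ 2 := by
          simp only [← Finset.mul_sum]
          rw [Finset.sum_comm]
          congr 1
          exact Finset.sum_congr rfl fun i _ => Finset.sum_comm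
      _ ≤ columnNorms K q y ^ 2 * ∑ i, ∑ l, ‖X i l‖ ^ 2 := by
          gcongr
          exact hφ _
      _ ≤ _ := by gcongr
  have hce : ∑ a : γ × (Fin p × Fin q), ‖c a.1 * η a.2‖ ^ 2 ≤ ∑ a, ‖η a‖ ^ 2 := by
    simp only [norm_mul, mul_pow]
    rw [Fintype.sum_prod_type]
    refine (Fintype.sum_mul_sum (fun g => ‖c g‖ ^ 2) fun a => ‖η a‖ ^ 2).symm.trans_le ?_
    exact mul_le_of_le_one_left (by positivity) hc
  calc _ ≤ ∑ a : γ × (Fin p × Fin q), ‖c a.1 * η a.2‖ * ‖ψ a.1 (Z a)‖ := by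
        rw [e]
        exact (norm_sum_le _ _).trans (Finset.sum_le_sum fun a _ => norm_mul_le _ _)
    _ ≤ √(∑ a : γ × (Fin p × Fin q), ‖c a.1 * η a.2‖ ^ 2) * √(∑ a, ‖ψ a.1 (Z a)‖ ^ 2) :=
        Real.sum_mul_le_sqrt_mul_sqrt _ _ _
    _ ≤ √(∑ a, ‖η a‖ ^ 2) *
        √(columnNorms K q y ^ 2 * (columnNorms H p x ^ 2 * ∑ b, ‖ξ b‖ ^ 2)) := by gcongr
    _ = _ := by
        rw [Real.sqrt_mul (sq_nonneg _), Real.sqrt_mul (sq_nonneg _), Real.sqrt_sq hx0,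
          Real.sqrt_sq hy0]
        ring

/-- A row of orthogonal vectors of norm at most one is a contraction for the column structure. -/
theorem columnNorms_le_one_of_orthogonal {p : ℕ} (i₀ : Fin p) (u : Fin p → H)
    (hu : Pairwise fun i j => inner ℂ (u i) (u j) = 0) (hu1 : ∀ i, ‖u i‖ ≤ 1) :
    columnNorms H p (Matrix.of fun i j => if i = i₀ then u j else 0) ≤ 1 := by
  rw [columnNorms, Real.sqrt_le_one]
  have : (Matrix.of fun i j => ∑ k, inner ℂ
      ((Matrix.of fun i j => if i = i₀ then u j else 0 : Matrix (Fin p) (Fin p) H) k i)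
      ((Matrix.of fun i j => if i = i₀ then u j else 0 : Matrix (Fin p) (Fin p) H) k j) :
      Matrix (Fin p) (Fin p) ℂ) = Matrix.diagonal fun i => ((‖u i‖ ^ 2 : ℝ) : ℂ) := by
    ext i j
    simp only [Matrix.of_apply, Matrix.diagonal_apply]
    rw [Finset.sum_eq_single i₀ (by intro k _ hk; simp [hk]) (by simp)]
    simp only [if_true]
    split_ifs with h
    · subst h
      rw [inner_self_eq_norm_sq_to_K]
      push_cast
      rfl
    · exact hu h
  rw [this, Matrix.l2_opNorm_diagonal, pi_norm_le_iff_of_nonneg zero_le_one]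
  intro i
  rw [Complex.norm_real, Real.norm_of_nonneg (by positivity)]
  exact pow_le_one₀ (norm_nonneg _) (hu1 i)

/-- `CB(H^c, (K^c)*)` consists of Hilbert–Schmidt forms: a jointly completely contractive form on
`H^c × K^c` has Hilbert–Schmidt norm at most one. The bound is stated in its dual form, and
for orthogonal systems that need not be normalized. -/
theorem norm_sum_le_of_column_column {B : H →ₗ[ℂ] K →ₗ[ℂ] ℂ}
    (hB : IsJointCompleteContraction (columnNorms H) (columnNorms K) B) {α β : Type*} [Fintype α]
    [Fintype β] (u : α → H) (v : β → K) (hu : Pairwise fun i j => inner ℂ (u i) (u j) = 0)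
    (hv : Pairwise fun i j => inner ℂ (v i) (v j) = 0) (C : α → β → ℂ) :
    ‖∑ i, ∑ j, C i j * B (u i) (v j)‖ ≤
      √(∑ i, ∑ j, ‖C i j‖ ^ 2 * (‖u i‖ ^ 2 * ‖v j‖ ^ 2)) := by
  have key : ∀ (p q : ℕ) (u : Fin p → H) (v : Fin q → K),
      (Pairwise fun i j => inner ℂ (u i) (u j) = 0) → (∀ i, ‖u i‖ ≤ 1) →
      (Pairwise fun i j => inner ℂ (v i) (v j) = 0) → (∀ i, ‖v i‖ ≤ 1) →
      ∀ D : Fin p → Fin q → ℂ,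
      ‖∑ i, ∑ j, D i j * B (u i) (v j)‖ ≤ √(∑ i, ∑ j, ‖D i j‖ ^ 2) := by
    intro p q u v hu hu1 hv hv1 D
    rcases isEmpty_or_nonempty (Fin p) with hp | ⟨⟨i₀⟩⟩
    · simp
    rcases isEmpty_or_nonempty (Fin q) with hq | ⟨⟨k₀⟩⟩
    · simp
    set x : Matrix (Fin p) (Fin p) H := Matrix.of fun i j => if i = i₀ then u j else 0 with hx
    set y : Matrix (Fin q) (Fin q) K := Matrix.of fun i j => if i = k₀ then v j else 0 with hy
    have h1 : ‖pairingMatrix B x y‖ ≤ 1 := (hB p q x y).trans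
      (mul_le_one₀ (columnNorms_le_one_of_orthogonal i₀ u hu hu1) (columnNorms_nonneg _ _)
        (columnNorms_le_one_of_orthogonal k₀ v hv hv1))
    have h2 := norm_bilin_le (pairingMatrix B x y) (Pi.single (i₀, k₀) 1) fun b => D b.1 b.2
    have e1 : ∑ a, ‖(Pi.single (i₀, k₀) 1 : Fin p × Fin q → ℂ) a‖ ^ 2 = 1 := by
      rw [Finset.sum_eq_single (i₀, k₀) (by intro a _ ha; simp [ha]) (by simp)]
      simp
    have e2 : ∑ a, ∑ b : Fin p × Fin q, (Pi.single (i₀, k₀) 1 : Fin p × Fin q → ℂ) a *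
        pairingMatrix B x y a b * D b.1 b.2 = ∑ i, ∑ j, D i j * B (u i) (v j) := by
      rw [Finset.sum_eq_single (i₀, k₀) (by intro a _ ha; simp [ha]) (by simp),
        Fintype.sum_prod_type]
      simp [pairingMatrix, hx, hy, mul_comm]
    rw [e1, e2, Real.sqrt_one, mul_one, Fintype.sum_prod_type] at h2
    exact h2.trans (mul_le_of_le_one_left (Real.sqrt_nonneg _) h1)
  set eα := (Fintype.equivFin α).symm
  set eβ := (Fintype.equivFin β).symm
  have h := key (Fintype.card α) (Fintype.card β)
    (fun i => ((‖u (eα i)‖⁻¹ : ℝ) : ℂ) • u (eα i)) (fun j => ((‖v (eβ j)‖⁻¹ : ℝ) : ℂ) • v (eβ j))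
    (fun i j hij => by
      simp only [inner_smul_left, inner_smul_right]
      rw [hu (eα.injective.ne hij)]
      simp)
    (fun i => by
      rw [norm_smul, Complex.norm_real, norm_inv, norm_norm]
      exact inv_mul_le_one)
    (fun i j hij => by
      simp only [inner_smul_left, inner_smul_right]
      rw [hv (eβ.injective.ne hij)]
      simp)
    (fun i => by
      rw [norm_smul, Complex.norm_real, norm_inv, norm_norm]
      exact inv_mul_le_one)
    (fun i j => C (eα i) (eβ j) * (‖u (eα i)‖ * ‖v (eβ j)‖ : ℝ))
  rw [← eα.sum_comp, ← eα.sum_comp]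
  simp_rw [← eβ.sum_comp (fun j => C _ j * B _ (v j)),
    ← eβ.sum_comp (fun j => ‖C _ j‖ ^ 2 * (‖u _‖ ^ 2 * ‖v j‖ ^ 2))]
  convert h using 2
  · refine Finset.sum_congr rfl fun i _ => Finset.sum_congr rfl fun j _ => ?_
    simp only [map_smul, LinearMap.smul_apply, smul_eq_mul]
    rcases eq_or_ne (u (eα i)) 0 with h0 | h0
    · simp [h0]
    rcases eq_or_ne (v (eβ j)) 0 with h0' | h0'
    · simp [h0']
    have h1 : (‖u (eα i)‖ : ℂ) ≠ 0 := by simpa using h0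
    have h2 : (‖v (eβ j)‖ : ℂ) ≠ 0 := by simpa using h0'
    push_cast
    field_simp
  · refine Finset.sum_congr rfl fun i _ => Finset.sum_congr rfl fun j _ => ?_
    rw [norm_mul, Complex.norm_real, norm_mul, norm_norm, norm_norm]
    ring

/-- A bounded form with coefficients `a` in the Hilbert–Schmidt class loses at most the factor
`√n`, the Hilbert–Schmidt norm of the identity. -/
theorem norm_sum_le_of_bounded {B : H →ₗ[ℂ] K →ₗ[ℂ] ℂ} (hB : ∀ x y, ‖B x y‖ ≤ ‖x‖ * ‖y‖) {n : ℕ}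
    (u : Fin n → H) (v : Fin n → K) {r s : ℝ} (hr : 0 ≤ r) (hs : 0 ≤ s) (hu : ∀ i, ‖u i‖ ≤ r)
    (hv1 : ∀ i, ‖v i‖ ≤ s)
    (hv : Pairwise fun i j => inner ℂ (v i) (v j) = 0) (a : Matrix (Fin n) (Fin n) ℂ) :
    ‖∑ i, ∑ j, a i j * B (u i) (v j)‖ ≤ √n * r * s * √(∑ i, ∑ j, ‖a i j‖ ^ 2) := by
  have h1 (i : Fin n) : ‖∑ j, a i j • v j‖ ≤ s * √(∑ j, ‖a i j‖ ^ 2) := by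
    rw [← Real.sqrt_sq hs, ← Real.sqrt_mul (sq_nonneg s)]
    refine Real.le_sqrt_of_sq_le ?_
    have e := inner_self_eq_norm_sq (𝕜 := ℂ) (∑ j, a i j • v j)
    rw [← e, sum_inner]
    simp only [inner_sum]
    have : ∀ j, ∑ l, inner ℂ (a i j • v j) (a i l • v l) = ((‖a i j‖ ^ 2 * ‖v j‖ ^ 2 : ℝ) : ℂ) := by
      intro j
      rw [Finset.sum_eq_single j (fun l _ hl => by
        rw [inner_smul_left, inner_smul_right, hv hl.symm]; simp) (by simp),
        inner_self_eq_norm_sq_to_K, norm_smul]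
      simp [mul_pow]
    simp only [this]
    rw [← Complex.ofReal_sum, Finset.mul_sum]
    change ((∑ j, ‖a i j‖ ^ 2 * ‖v j‖ ^ 2 : ℝ) : ℂ).re ≤ _
    rw [Complex.ofReal_re]
    refine Finset.sum_le_sum fun j _ => ?_
    rw [mul_comm]
    gcongr
    exact hv1 j
  calc ‖∑ i, ∑ j, a i j * B (u i) (v j)‖ = ‖∑ i, B (u i) (∑ j, a i j • v j)‖ := by
        simp [map_sum]
    _ ≤ ∑ i, r * (s * √(∑ j, ‖a i j‖ ^ 2)) :=
        (norm_sum_le _ _).trans (Finset.sum_le_sum fun i _ => (hB _ _).trans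
          (mul_le_mul (hu i) (h1 i) (norm_nonneg _) hr))
    _ = r * s * ∑ i, 1 * √(∑ j, ‖a i j‖ ^ 2) := by
        rw [Finset.mul_sum]
        exact Finset.sum_congr rfl fun i _ => by ring
    _ ≤ r * s * (√(∑ i : Fin n, 1 ^ 2) * √(∑ i, √(∑ j, ‖a i j‖ ^ 2) ^ 2)) := by
        gcongr
        exact Real.sum_mul_le_sqrt_mul_sqrt _ _ _
    _ = _ := by
        have : ∀ i, √(∑ j, ‖a i j‖ ^ 2) ^ 2 = ∑ j, ‖a i j‖ ^ 2 := fun i =>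
          Real.sq_sqrt (by positivity)
        simp only [this, one_pow, Finset.sum_const, Finset.card_univ, Fintype.card_fin,
          nsmul_eq_mul, mul_one]
        ring

theorem norm_of_inner_self (z : H) :
    ‖(Matrix.of fun _ _ => inner ℂ z z : Matrix (Fin 1) (Fin 1) ℂ)‖ = ‖z‖ ^ 2 := by
  have : (Matrix.of fun _ _ => inner ℂ z z : Matrix (Fin 1) (Fin 1) ℂ) =
      Matrix.diagonal fun _ => inner ℂ z z := by
    ext i j
    simp [Subsingleton.elim i j]
  rw [this, Matrix.l2_opNorm_diagonal]
  simp [inner_self_eq_norm_sq_to_K]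

/-- A jointly completely contractive form on `H^r × K^c` is contractive. -/
theorem IsJointCompleteContraction.norm_le_of_row_column {B : H →ₗ[ℂ] K →ₗ[ℂ] ℂ}
    (hB : IsJointCompleteContraction (rowNorms H) (columnNorms K) B) (x : H) (y : K) :
    ‖B x y‖ ≤ ‖x‖ * ‖y‖ := by
  have h := hB 1 1 (Matrix.of fun _ _ => x) (Matrix.of fun _ _ => y)
  have h1 : rowNorms H 1 (Matrix.of fun _ _ => x) = ‖x‖ := by
    rw [rowNorms]
    simp only [Finset.univ_unique, Finset.sum_singleton, Matrix.of_apply]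
    rw [norm_of_inner_self, Real.sqrt_sq (norm_nonneg _)]
  have h2 : columnNorms K 1 (Matrix.of fun _ _ => y) = ‖y‖ := by
    rw [columnNorms]
    simp only [Finset.univ_unique, Finset.sum_singleton, Matrix.of_apply]
    rw [norm_of_inner_self, Real.sqrt_sq (norm_nonneg _)]
  rw [h1, h2] at h
  refine le_trans (le_of_eq ?_) h
  have : (Matrix.of fun a b => B ((Matrix.of fun _ _ => x : Matrix (Fin 1) (Fin 1) H) a.1 b.1)
        ((Matrix.of fun _ _ => y : Matrix (Fin 1) (Fin 1) K) a.2 b.2) :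
      Matrix (Fin 1 × Fin 1) (Fin 1 × Fin 1) ℂ) = Matrix.diagonal fun _ => B x y := by
    ext a b
    simp [Subsingleton.elim a b]
  rw [this, Matrix.l2_opNorm_diagonal]
  simp

end JointComplete

/-! ### Direct sums and quotients -/

section SumsAndQuotients

open scoped Matrix.Norms.L2Operator

variable {V W V' W' : Type*} [AddCommGroup V] [Module ℂ V] [AddCommGroup W] [Module ℂ W]
  [AddCommGroup V'] [Module ℂ V'] [AddCommGroup W'] [Module ℂ W']

theorem l1SumNorms_nonneg (N : MatrixNorms V) (N' : MatrixNorms W) (m : ℕ)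
    (z : Matrix (Fin m) (Fin m) (V × W)) : 0 ≤ l1SumNorms N N' m z :=
  Real.sSup_nonneg (by rintro r ⟨k, u, v, -, -, rfl⟩; exact norm_nonneg _)

theorem quotientNorms_nonneg {N : MatrixNorms V} (hN : ∀ m x, 0 ≤ N m x) (S : Submodule ℂ V)
    (m : ℕ) (x : Matrix (Fin m) (Fin m) (V ⧸ S)) : 0 ≤ quotientNorms N S m x :=
  Real.sInf_nonneg (by rintro r ⟨y, -, rfl⟩; exact hN m y)

theorem quotientNorms_mkQ_le {N : MatrixNorms V} (hN : ∀ m x, 0 ≤ N m x) (S : Submodule ℂ V)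
    (m : ℕ) (y : Matrix (Fin m) (Fin m) V) : quotientNorms N S m (y.map S.mkQ) ≤ N m y :=
  csInf_le ⟨0, by rintro r ⟨y, -, rfl⟩; exact hN m y⟩ ⟨y, rfl, rfl⟩

theorem l1SumNorms_inl_le {N : MatrixNorms V} (N' : MatrixNorms W) (hN : ∀ m x, 0 ≤ N m x) (m : ℕ)
    (x : Matrix (Fin m) (Fin m) V) :
    l1SumNorms N N' m (x.map (LinearMap.inl ℂ V W)) ≤ N m x := by
  refine Real.sSup_le ?_ (hN m x)
  rintro r ⟨k, u, v, hu, -, rfl⟩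
  simpa using hu m x

theorem l1SumNorms_inr_le (N : MatrixNorms V) {N' : MatrixNorms W} (hN : ∀ m x, 0 ≤ N' m x) (m : ℕ)
    (x : Matrix (Fin m) (Fin m) W) :
    l1SumNorms N N' m (x.map (LinearMap.inr ℂ V W)) ≤ N' m x := by
  refine Real.sSup_le ?_ (hN m x)
  rintro r ⟨k, u, v, -, hv, rfl⟩
  simpa using hv m x

theorem IsJointCompleteContraction.compl₁₂ {N : MatrixNorms V} {N' : MatrixNorms W}
    {B : V →ₗ[ℂ] W →ₗ[ℂ] ℂ} (hB : IsJointCompleteContraction N N' B)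
    (hN' : ∀ m x, 0 ≤ N' m x) {M : MatrixNorms V'} {M' : MatrixNorms W'} (hM : ∀ m x, 0 ≤ M m x)
    (S : V' →ₗ[ℂ] V) (T : W' →ₗ[ℂ] W) (hS : ∀ m x, N m (x.map S) ≤ M m x)
    (hT : ∀ m x, N' m (x.map T) ≤ M' m x) :
    IsJointCompleteContraction M M' (B.compl₁₂ S T) := fun p q x y =>
  (hB p q (x.map S) (y.map T)).trans (mul_le_mul (hS p x) (hT q y) (hN' _ _) (hM _ _))

theorem le_csInf_mul {S : Set ℝ} (hS : S.Nonempty) {c d : ℝ} (hd : 0 ≤ d)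
    (h : ∀ r ∈ S, c ≤ r * d) : c ≤ sInf S * d := by
  rcases hd.eq_or_lt with rfl | hd
  · obtain ⟨r, hr⟩ := hS
    simpa using h r hr
  · exact (div_le_iff₀ hd).1 (le_csInf hS fun r hr => (div_le_iff₀ hd).2 (h r hr))

theorem exists_map_mkQ_eq (S : Submodule ℂ V) {m : ℕ} (x : Matrix (Fin m) (Fin m) (V ⧸ S)) :
    ∃ y : Matrix (Fin m) (Fin m) V, y.map S.mkQ = x := by
  choose g hg using S.mkQ_surjective
  exact ⟨x.map g, by ext i j; exact hg _⟩

/-- Joint complete contractivity on a quotient can be checked on representatives. -/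
theorem isJointCompleteContraction_quotientNorms {N : MatrixNorms V} {N' : MatrixNorms W}
    (hN : ∀ m x, 0 ≤ N m x) (hN' : ∀ m x, 0 ≤ N' m x) {S : Submodule ℂ V} {T : Submodule ℂ W}
    {B : V ⧸ S →ₗ[ℂ] W ⧸ T →ₗ[ℂ] ℂ}
    (hB : IsJointCompleteContraction N N' (B.compl₁₂ S.mkQ T.mkQ)) :
    IsJointCompleteContraction (quotientNorms N S) (quotientNorms N' T) B := by
  intro p q x y
  obtain ⟨x₀, hx₀⟩ := exists_map_mkQ_eq S x
  obtain ⟨y₀, hy₀⟩ := exists_map_mkQ_eq T y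
  have hy := quotientNorms_nonneg hN' T q y
  unfold quotientNorms at hy ⊢
  refine le_csInf_mul ?_ hy ?_
  · exact ⟨_, x₀, hx₀, rfl⟩
  rintro _ ⟨x₁, rfl, rfl⟩
  rw [mul_comm]
  refine le_csInf_mul ?_ (hN _ _) ?_
  · exact ⟨_, y₀, hy₀, rfl⟩
  rintro _ ⟨y₁, rfl, rfl⟩
  rw [mul_comm]
  exact hB p q x₁ y₁

/-- The universal property of `V ⊕₁ W`: a map to `M_k` is completely bounded by `d` as soon as its
restrictions to `V` and `W` are. -/
theorem norm_le_mul_l1SumNorms {N : MatrixNorms V} {N' : MatrixNorms W} {k : ℕ}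
    (Θ : V × W →ₗ[ℂ] Matrix (Fin k) (Fin k) ℂ) {d : ℝ} (hd : 0 ≤ d)
    (h₁ : ∀ (m : ℕ) (x : Matrix (Fin m) (Fin m) V),
      ‖(Matrix.of fun a b => Θ (x a.1 b.1, 0) a.2 b.2 :
        Matrix (Fin m × Fin k) (Fin m × Fin k) ℂ)‖ ≤ d * N m x)
    (h₂ : ∀ (m : ℕ) (y : Matrix (Fin m) (Fin m) W),
      ‖(Matrix.of fun a b => Θ (0, y a.1 b.1) a.2 b.2 :
        Matrix (Fin m × Fin k) (Fin m × Fin k) ℂ)‖ ≤ d * N' m y)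
    (m : ℕ) (z : Matrix (Fin m) (Fin m) (V × W)) :
    ‖(Matrix.of fun a b => Θ (z a.1 b.1) a.2 b.2 :
      Matrix (Fin m × Fin k) (Fin m × Fin k) ℂ)‖ ≤ d * l1SumNorms N N' m z := by
  have hΘ (x : V) (y : W) : Θ (x, y) = Θ (x, 0) + Θ (0, y) := by rw [← map_add]; simp
  have e : (Matrix.of fun a b => Θ (z a.1 b.1) a.2 b.2 :
      Matrix (Fin m × Fin k) (Fin m × Fin k) ℂ) =
      (Matrix.of fun a b => Θ ((z a.1 b.1).1, 0) a.2 b.2) +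
        Matrix.of fun a b => Θ (0, (z a.1 b.1).2) a.2 b.2 := by
    ext a b
    simp only [Matrix.of_apply, Matrix.add_apply]
    rw [← Matrix.add_apply, ← hΘ]
  rcases hd.eq_or_lt with rfl | hd
  · rw [e, zero_mul]
    refine (norm_add_le _ _).trans ?_
    have := h₁ m (z.map Prod.fst)
    have := h₂ m (z.map Prod.snd)
    simp only [zero_mul, Matrix.map_apply] at *
    linarith
  · have key : ∀ (l : ℕ) (Z : Matrix (Fin l × Fin k) (Fin l × Fin k) ℂ),
        ‖((d⁻¹ : ℝ) : ℂ) • Z‖ = d⁻¹ * ‖Z‖ := fun l Z => by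
      rw [norm_smul, Complex.norm_real, Real.norm_of_nonneg (by positivity)]
    have hsmul : ∀ (l : ℕ) (Z : Matrix (Fin l × Fin k) (Fin l × Fin k) ℂ) (r : ℝ),
        ‖Z‖ ≤ d * r → ‖((d⁻¹ : ℝ) : ℂ) • Z‖ ≤ r := fun l Z r hZ => by
      rw [key, inv_mul_le_iff₀ hd]
      exact hZ
    rw [← inv_mul_le_iff₀ hd, ← key]
    refine le_csSup (bddAbove_l1SumSet N N' m z) ⟨k,
      ((d⁻¹ : ℝ) : ℂ) • Θ ∘ₗ LinearMap.inl ℂ V W, ((d⁻¹ : ℝ) : ℂ) • Θ ∘ₗ LinearMap.inr ℂ V W,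
      fun l x => hsmul l _ _ (h₁ l x), fun l y => hsmul l _ _ (h₂ l y), ?_⟩
    rw [e, smul_add]
    rfl

/-- The linear map `z ↦ [B(z, w_{kl})]`. -/
def slice (B : V →ₗ[ℂ] W →ₗ[ℂ] ℂ) {q : ℕ} (w : Matrix (Fin q) (Fin q) W) :
    V →ₗ[ℂ] Matrix (Fin q) (Fin q) ℂ where
  toFun z := Matrix.of fun k l => B z (w k l)
  map_add' z z' := by ext; simp
  map_smul' c z := by ext; simp

/-- Joint complete contractivity on `V ⊕₁ W` in the first variable. -/
theorem isJointCompleteContraction_l1SumNorms_left {N : MatrixNorms V} {N' : MatrixNorms W}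
    {M : MatrixNorms V'} (hM : ∀ m x, 0 ≤ M m x) {B : V × W →ₗ[ℂ] V' →ₗ[ℂ] ℂ}
    (h₁ : IsJointCompleteContraction N M (B ∘ₗ LinearMap.inl ℂ V W))
    (h₂ : IsJointCompleteContraction N' M (B ∘ₗ LinearMap.inr ℂ V W)) :
    IsJointCompleteContraction (l1SumNorms N N') M B := by
  intro p q x y
  rw [mul_comm]
  refine norm_le_mul_l1SumNorms (slice B y) (hM q y) (fun m z => ?_) (fun m z => ?_) p x
  · rw [mul_comm]
    exact h₁ m q z y
  · rw [mul_comm]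
    exact h₂ m q z y

/-- A bilinear form on `ℓ₁`-sums is jointly completely contractive if its four blocks are. -/
theorem isJointCompleteContraction_l1SumNorms {N : MatrixNorms V} {N' : MatrixNorms W}
    {M : MatrixNorms V'} {M' : MatrixNorms W'} (hN : ∀ m x, 0 ≤ N m x) (hN' : ∀ m x, 0 ≤ N' m x)
    {B : V × W →ₗ[ℂ] V' × W' →ₗ[ℂ] ℂ}
    (h₁₁ : IsJointCompleteContraction N M
      (B.compl₁₂ (LinearMap.inl ℂ V W) (LinearMap.inl ℂ V' W')))
    (h₁₂ : IsJointCompleteContraction N M'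
      (B.compl₁₂ (LinearMap.inl ℂ V W) (LinearMap.inr ℂ V' W')))
    (h₂₁ : IsJointCompleteContraction N' M
      (B.compl₁₂ (LinearMap.inr ℂ V W) (LinearMap.inl ℂ V' W')))
    (h₂₂ : IsJointCompleteContraction N' M'
      (B.compl₁₂ (LinearMap.inr ℂ V W) (LinearMap.inr ℂ V' W'))) :
    IsJointCompleteContraction (l1SumNorms N N') (l1SumNorms M M') B := by
  have h₁ : IsJointCompleteContraction (l1SumNorms M M') N (B ∘ₗ LinearMap.inl ℂ V W).flip :=
    isJointCompleteContraction_l1SumNorms_left hN (fun p q x y => h₁₁.flip p q x y)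
      fun p q x y => h₁₂.flip p q x y
  have h₂ : IsJointCompleteContraction (l1SumNorms M M') N' (B ∘ₗ LinearMap.inr ℂ V W).flip :=
    isJointCompleteContraction_l1SumNorms_left hN' (fun p q x y => h₂₁.flip p q x y)
      fun p q x y => h₂₂.flip p q x y
  exact isJointCompleteContraction_l1SumNorms_left (l1SumNorms_nonneg M M') h₁.flip h₂.flip

end SumsAndQuotients

/-! ### The measures and the dyadic pieces -/

section MeasureEstimates

open Set

instance : IsFiniteMeasure μ := ⟨μ_univ_lt_top⟩

theorem μ_apply {A : Set ℝ} (hA : MeasurableSet A) :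
    μ A = ∫⁻ t in A ∩ Ioo 0 1, ENNReal.ofReal (1 / (Real.pi * √(t * (1 - t)))) := by
  rw [μ, withDensity_apply _ hA, Measure.restrict_restrict hA]

/-- `μ` is invariant under the reflection `t ↦ 1 - t`. -/
theorem measurePreserving_one_sub : MeasurePreserving (fun t : ℝ => 1 - t) μ μ := by
  have hm : Measurable fun t : ℝ => 1 - t := by fun_prop
  refine ⟨hm, Measure.ext fun A hA => ?_⟩
  rw [Measure.map_apply hm hA, μ_apply (hm hA), μ_apply hA,
    ← lintegral_indicator ((hm hA).inter measurableSet_Ioo),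
    ← lintegral_indicator (hA.inter measurableSet_Ioo),
    ← lintegral_sub_left_eq_self _ (1 : ℝ)]
  refine lintegral_congr fun t => ?_
  have h : (1 - t ∈ (fun t : ℝ => 1 - t) ⁻¹' A ∩ Ioo 0 1) ↔ t ∈ A ∩ Ioo 0 1 := by
    simp only [mem_inter_iff, mem_preimage, mem_Ioo, sub_sub_cancel]
    constructor <;> rintro ⟨h1, h2, h3⟩ <;> exact ⟨h1, by linarith, by linarith⟩
  by_cases ht : t ∈ A ∩ Ioo 0 1
  · rw [indicator_of_mem (h.2 ht), indicator_of_mem ht, sub_sub_cancel, mul_comm t]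
  · rw [indicator_of_notMem (mt h.1 ht), indicator_of_notMem ht]

theorem ν₁_preimage_one_sub {A : Set ℝ} (hA : MeasurableSet A) :
    ν₁ ((fun t => 1 - t) ⁻¹' A) = ν₂ A := by
  have hm : Measurable fun t : ℝ => 1 - t := by fun_prop
  rw [ν₁, ν₂, withDensity_apply _ (hm hA), withDensity_apply _ hA,
    ← measurePreserving_one_sub.setLIntegral_comp_preimage hA (by fun_prop)]
  simp only [sub_sub_cancel]

theorem ν₂_preimage_one_sub {A : Set ℝ} (hA : MeasurableSet A) :
    ν₂ ((fun t => 1 - t) ⁻¹' A) = ν₁ A := by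
  have hm : Measurable fun t : ℝ => 1 - t := by fun_prop
  rw [← ν₁_preimage_one_sub (hm hA), ← preimage_comp]
  congr 1
  ext t
  simp

theorem μ_le_ν₁ : μ ≤ ν₁ := by
  refine Measure.le_iff.2 fun A hA => ?_
  rw [ν₁, withDensity_apply _ hA, ← setLIntegral_one]
  refine lintegral_mono_ae ?_
  filter_upwards [ae_restrict_of_ae ae_mem_Ioo] with t ht
  exact ENNReal.one_le_ofReal.2 ((one_le_inv₀ ht.1).2 ht.2.le)

theorem μ_le_ν₂ : μ ≤ ν₂ := by
  refine Measure.le_iff.2 fun A hA => ?_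
  rw [ν₂, withDensity_apply _ hA, ← setLIntegral_one]
  refine lintegral_mono_ae ?_
  filter_upwards [ae_restrict_of_ae ae_mem_Ioo] with t ht
  exact ENNReal.one_le_ofReal.2 ((one_le_inv₀ (by linarith [ht.2])).2 (by linarith [ht.1]))

theorem ν₁_le_of_subset {A : Set ℝ} (hA : MeasurableSet A) {c : ℝ} (hc : 0 < c)
    (h : A ⊆ Ici c) : ν₁ A ≤ ENNReal.ofReal c⁻¹ * μ A := by
  rw [ν₁, withDensity_apply _ hA, ← setLIntegral_const]
  refine setLIntegral_mono' hA fun t ht => ENNReal.ofReal_le_ofReal ?_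
  exact inv_anti₀ hc (h ht)

theorem ν₁_ne_top {A : Set ℝ} (hA : MeasurableSet A) {c : ℝ} (hc : 0 < c)
    (h : A ⊆ Ici c) : ν₁ A ≠ ⊤ :=
  ((ν₁_le_of_subset hA hc h).trans_lt
    (ENNReal.mul_lt_top ENNReal.ofReal_lt_top (measure_lt_top _ _))).ne

theorem ν₁_real_le_of_subset {A : Set ℝ} (hA : MeasurableSet A) {c : ℝ} (hc : 0 < c)
    (h : A ⊆ Ici c) : ν₁.real A ≤ c⁻¹ * μ.real A := by
  have := ENNReal.toReal_mono
    (ENNReal.mul_lt_top ENNReal.ofReal_lt_top (measure_lt_top _ _)).ne (ν₁_le_of_subset hA hc h)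
  rwa [ENNReal.toReal_mul, ENNReal.toReal_ofReal (by positivity)] at this

theorem μ_real_Ioc_le (m : ℕ) :
    μ.real (Ioc 0 (1 / 2 * (1 / 4) ^ m)) ≤ 2 / Real.pi * (1 / 2) ^ m := by
  have hpi := Real.pi_pos
  set x : ℝ := 1 / 2 * (1 / 4) ^ m with hx
  have hx0 : 0 < x := by positivity
  have hx1 : x ≤ 1 / 2 := by
    have : ((1 : ℝ) / 4) ^ m ≤ 1 := pow_le_one₀ (by norm_num) (by norm_num)
    linarith
  have hint : IntervalIntegrable (fun t : ℝ => √2 / Real.pi * t ^ (-(1 / 2) : ℝ)) volume 0 x :=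
    (intervalIntegral.intervalIntegrable_rpow' (by norm_num)).const_mul _
  have hval : ∫ t in (0 : ℝ)..x, √2 / Real.pi * t ^ (-(1 / 2) : ℝ) = 2 / Real.pi * (1 / 2) ^ m := by
    rw [intervalIntegral.integral_const_mul, integral_rpow (Or.inl (by norm_num))]
    norm_num
    rw [← Real.sqrt_eq_rpow, hx, Real.sqrt_mul (by norm_num)]
    have : √((1 / 4 : ℝ) ^ m) = (1 / 2) ^ m := by
      rw [show (1 / 4 : ℝ) ^ m = ((1 / 2) ^ m) ^ 2 by rw [← pow_mul, mul_comm, pow_mul]; norm_num]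
      exact Real.sqrt_sq (by positivity)
    have h2 : √2 * √(1 / 2 : ℝ) = 1 := by
      rw [← Real.sqrt_mul (by norm_num)]
      norm_num
    rw [this]
    linear_combination 2 / Real.pi * (1 / 2) ^ m * h2
  refine ENNReal.toReal_le_of_le_ofReal (by positivity) ?_
  rw [μ_apply measurableSet_Ioc, ← hval, intervalIntegral.integral_of_le hx0.le,
    ofReal_integral_eq_lintegral_ofReal ((intervalIntegrable_iff_integrableOn_Ioc_of_le hx0.le).1
      hint)]
  · refine (setLIntegral_mono' (measurableSet_Ioc.inter measurableSet_Ioo) fun t ht => ?_).trans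
      (lintegral_mono_set inter_subset_left)
    have ht0 : 0 < t := ht.1.1
    have ht1 : 1 / 2 ≤ 1 - t := by linarith [ht.1.2]
    refine ENNReal.ofReal_le_ofReal ?_
    rw [Real.rpow_neg ht0.le, ← Real.sqrt_eq_rpow, Real.sqrt_mul ht0.le]
    have hs : 0 < √t := Real.sqrt_pos.2 ht0
    have h1 : 1 ≤ √2 * √(1 - t) := by
      rw [← Real.sqrt_mul (by norm_num)]
      exact Real.one_le_sqrt.2 (by linarith)
    have h0 : 0 < √(1 - t) := Real.sqrt_pos.2 (by linarith)
    rw [div_mul_eq_mul_div, div_le_div_iff₀ (by positivity) hpi, one_mul]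
    calc Real.pi = Real.pi * 1 := (mul_one _).symm
      _ ≤ Real.pi * (√2 * √(1 - t)) := by gcongr
      _ = _ := by field_simp
  · filter_upwards [ae_restrict_mem measurableSet_Ioc] with t ht
    have := ht.1
    simp only [Pi.zero_apply]
    positivity

theorem le_μ_real_Ioc (m : ℕ) :
    3 / (4 * Real.pi) * (1 / 2) ^ m ≤ μ.real (Ioc ((1 / 4) ^ (m + 1)) ((1 / 4) ^ m)) := by
  have hpi := Real.pi_pos
  set x : ℝ := (1 / 2) ^ m with hx
  have hx0 : 0 < x := by positivity
  have hxx : ((1 : ℝ) / 4) ^ m = x ^ 2 := by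
    rw [hx, ← pow_mul, mul_comm, pow_mul]; norm_num
  have hx1 : x ≤ 1 := pow_le_one₀ (by norm_num) (by norm_num)
  rw [pow_succ, hxx, measureReal_def, ← ENNReal.ofReal_le_iff_le_toReal (measure_ne_top _ _)]
  have hsub : Ioo (x ^ 2 * (1 / 4)) (x ^ 2) ⊆ Ioc (x ^ 2 * (1 / 4)) (x ^ 2) ∩ Ioo 0 1 :=
    fun t ht => ⟨⟨ht.1, ht.2.le⟩, lt_trans (by positivity) ht.1, ht.2.trans_le (by nlinarith)⟩
  calc ENNReal.ofReal (3 / (4 * Real.pi) * x)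
      = ENNReal.ofReal (1 / (Real.pi * x)) * volume (Ioo (x ^ 2 * (1 / 4)) (x ^ 2)) := by
        rw [Real.volume_Ioo, ← ENNReal.ofReal_mul (by positivity)]
        congr 1
        field_simp
        ring
    _ = ∫⁻ _ in Ioo (x ^ 2 * (1 / 4)) (x ^ 2), ENNReal.ofReal (1 / (Real.pi * x)) :=
        (setLIntegral_const _ _).symm
    _ ≤ ∫⁻ t in Ioo (x ^ 2 * (1 / 4)) (x ^ 2), ENNReal.ofReal (1 / (Real.pi * √(t * (1 - t)))) := by
        refine setLIntegral_mono' measurableSet_Ioo fun t ht => ENNReal.ofReal_le_ofReal ?_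
        have ht' := (hsub ht).2
        have h1 : 0 < t * (1 - t) := mul_pos ht'.1 (by linarith [ht'.2])
        have h2 : √(t * (1 - t)) ≤ x := by
          rw [Real.sqrt_le_left hx0.le]
          nlinarith [ht.2, ht'.1]
        have h3 := Real.sqrt_pos.2 h1
        gcongr
    _ ≤ _ := by
        rw [μ_apply measurableSet_Ioc]
        exact lintegral_mono_set hsub

/-- The dyadic pieces of `(0, 1/2]`: `(4^{-m-1}/2, 4^{-m}/2]` for `m < M` and the remainder
`(0, 4^{-M}/2]` for `m = M`. -/
def cell (M m : ℕ) : Set ℝ :=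
  Ioc (if m < M then 1 / 2 * (1 / 4) ^ (m + 1) else 0) (1 / 2 * (1 / 4) ^ m)

theorem measurableSet_cell (M m : ℕ) : MeasurableSet (cell M m) := measurableSet_Ioc

theorem measurableSet_preimage_cell (M m : ℕ) :
    MeasurableSet ((fun t : ℝ => 1 - t) ⁻¹' cell M m) :=
  (by fun_prop : Measurable fun t : ℝ => 1 - t) (measurableSet_cell M m)

theorem half_mul_pow_anti {m m' : ℕ} (h : m ≤ m') :
    (1 / 2 * (1 / 4) ^ m' : ℝ) ≤ 1 / 2 * (1 / 4) ^ m :=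
  mul_le_mul_of_nonneg_left (pow_le_pow_of_le_one (by norm_num) (by norm_num) h) (by norm_num)

theorem cell_subset_Ioc {M m m' : ℕ} (h : m ≤ m') : cell M m' ⊆ Ioc 0 (1 / 2 * (1 / 4) ^ m) := by
  rintro t ⟨h1, h2⟩
  refine ⟨lt_of_le_of_lt ?_ h1, h2.trans (half_mul_pow_anti h)⟩
  split_ifs <;> positivity

theorem disjoint_cell {M m m' : ℕ} (hm : m < m') (hM : m' ≤ M) :
    Disjoint (cell M m) (cell M m') := by
  refine Set.disjoint_left.2 fun t ht ht' => ?_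
  have h1 := ht.1
  rw [if_pos (hm.trans_le hM)] at h1
  exact absurd (h1.trans_le ht'.2) (not_lt.2 (half_mul_pow_anti hm))

theorem pairwise_disjoint_cell (M : ℕ) :
    Pairwise fun m m' : Fin (M + 1) => Disjoint (cell M m) (cell M m') := by
  intro m m' h
  rcases lt_or_gt_of_ne h with h | h
  · exact disjoint_cell h (Nat.lt_succ_iff.1 m'.2)
  · exact (disjoint_cell h (Nat.lt_succ_iff.1 m.2)).symm

theorem preimage_cell_subset (M m : ℕ) : (fun t : ℝ => 1 - t) ⁻¹' cell M m ⊆ Ici (1 / 2) := by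
  intro t ht
  have h := (cell_subset_Ioc (Nat.zero_le m) ht).2
  simp only [pow_zero, mul_one] at h
  exact mem_Ici.2 (by linarith)

theorem ν₁_preimage_cell_ne_top (M m : ℕ) : ν₁ ((fun t : ℝ => 1 - t) ⁻¹' cell M m) ≠ ⊤ :=
  ν₁_ne_top (measurableSet_preimage_cell M m) (by norm_num) (preimage_cell_subset M m)

theorem ν₂_cell_ne_top (M m : ℕ) : ν₂ (cell M m) ≠ ⊤ := by
  rw [← ν₁_preimage_one_sub (measurableSet_cell M m)]
  exact ν₁_preimage_cell_ne_top M m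

theorem cell_subset_Ici {M m : ℕ} (hm : m < M) : cell M m ⊆ Ici (1 / 2 * (1 / 4) ^ (m + 1)) := by
  intro t ht
  have h1 := ht.1
  rw [if_pos hm] at h1
  exact h1.le

theorem ν₁_cell_ne_top {M m : ℕ} (hm : m < M) : ν₁ (cell M m) ≠ ⊤ :=
  ν₁_ne_top (measurableSet_cell M m) (by positivity) (cell_subset_Ici hm)

theorem ν₂_preimage_cell_ne_top {M m : ℕ} (hm : m < M) :
    ν₂ ((fun t : ℝ => 1 - t) ⁻¹' cell M m) ≠ ⊤ := by
  rw [ν₂_preimage_one_sub (measurableSet_cell M m)]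
  exact ν₁_cell_ne_top hm

theorem ν₁_real_cell_le {M m : ℕ} (hm : m < M) : ν₁.real (cell M m) ≤ 16 / Real.pi * 2 ^ m := by
  refine (ν₁_real_le_of_subset (measurableSet_cell M m) (by positivity)
    (cell_subset_Ici hm)).trans ?_
  calc (1 / 2 * (1 / 4) ^ (m + 1) : ℝ)⁻¹ * μ.real (cell M m)
      ≤ (1 / 2 * (1 / 4) ^ (m + 1) : ℝ)⁻¹ * (2 / Real.pi * (1 / 2) ^ m) := by
        gcongr
        exact (measureReal_mono (cell_subset_Ioc le_rfl)).trans (μ_real_Ioc_le m)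
    _ = 16 / Real.pi * (2 * (2 * (1 / 2))) ^ m := by
        rw [pow_succ, mul_inv, mul_inv, ← inv_pow, mul_pow, mul_pow]
        norm_num
        rw [show (4 : ℝ) = 2 * 2 by norm_num, mul_pow]
        ring
    _ = _ := by norm_num

theorem sum_ν₁_real_preimage_cell_le (M : ℕ) (m : ℕ) :
    ∑ m' : Fin (M + 1), (if m ≤ m' then ν₁.real ((fun t : ℝ => 1 - t) ⁻¹' cell M m') else 0) ≤
      4 / Real.pi * (1 / 2) ^ m := by
  have h1 (m' : ℕ) : ν₁.real ((fun t : ℝ => 1 - t) ⁻¹' cell M m') ≤ 2 * μ.real (cell M m') := by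
    have := ν₁_real_le_of_subset (measurableSet_preimage_cell M m') (by norm_num)
      (preimage_cell_subset M m')
    rw [measureReal_def, measureReal_def,
      measurePreserving_one_sub.measure_preimage (measurableSet_cell M m').nullMeasurableSet,
      ← measureReal_def] at this
    norm_num at this
    exact this
  rw [← Finset.sum_filter]
  set S : Finset (Fin (M + 1)) := Finset.univ.filter fun m' => m ≤ m' with hS
  calc _ ≤ ∑ m' ∈ S, 2 * μ.real (cell M m') :=
        Finset.sum_le_sum fun m' _ => h1 m'
    _ = 2 * μ.real (⋃ m' ∈ S, cell M m') := by
        rw [← Finset.mul_sum, measureReal_biUnion_finset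
          (fun i _ j _ hij => pairwise_disjoint_cell M hij) fun i _ => measurableSet_cell M i]
    _ ≤ 2 * μ.real (Ioc 0 (1 / 2 * (1 / 4) ^ m)) := by
        refine mul_le_mul_of_nonneg_left (measureReal_mono
          (iUnion₂_subset fun m' hm' => cell_subset_Ioc ?_) (measure_ne_top _ _)) zero_le_two
        simpa [hS] using hm'
    _ ≤ 2 * (2 / Real.pi * (1 / 2) ^ m) := by gcongr; exact μ_real_Ioc_le m
    _ = _ := by ring

end MeasureEstimates

/-! ### Indicator functions in `G_n` -/

section CanonicalVectors

open Set

/-- The element `1_A e_k` of `L₂(ν; ℓ₂ⁿ)`, with the junk value `0` if `A` is not measurable or has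
infinite measure. -/
noncomputable def indVec (n : ℕ) (ν : Measure ℝ) (A : Set ℝ) (k : Fin n) : L2 ν n :=
  open Classical in
  if h : MeasurableSet A ∧ ν A ≠ ⊤ then
    indicatorConstLp 2 h.1 h.2 (EuclideanSpace.single k (1 : ℂ)) else 0

variable {n : ℕ} {ν : Measure ℝ}

theorem indVec_eq {A : Set ℝ} (hA : MeasurableSet A) (hν : ν A ≠ ⊤) (k : Fin n) :
    indVec n ν A k = indicatorConstLp 2 hA hν (EuclideanSpace.single k (1 : ℂ)) := by
  rw [indVec, dif_pos ⟨hA, hν⟩]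

theorem norm_sq_indVec_le (A : Set ℝ) (k : Fin n) : ‖indVec n ν A k‖ ^ 2 ≤ ν.real A := by
  rw [indVec]
  split_ifs with h
  · rw [norm_indicatorConstLp (by norm_num) (by norm_num), PiLp.norm_single, norm_one,
      one_mul, ENNReal.toReal_ofNat, ← Real.sqrt_eq_rpow, Real.sq_sqrt measureReal_nonneg]
  · simp

theorem inner_indVec {A B : Set ℝ} {i j : Fin n} (h : i ≠ j ∨ Disjoint A B) :
    inner ℂ (indVec n ν A i) (indVec n ν B j) = 0 := by
  rw [indVec, indVec]
  split_ifs with h1 h2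
  · rw [L2.inner_indicatorConstLp_indicatorConstLp (hμs := h1.2) (hμt := h2.2)]
    rcases h with h | h
    · simp [EuclideanSpace.inner_single_left, h]
    · simp [Set.disjoint_iff_inter_eq_empty.1 h]
  all_goals simp

theorem indVec_union {A B : Set ℝ} (hA : MeasurableSet A) (hB : MeasurableSet B) (hνA : ν A ≠ ⊤)
    (hνB : ν B ≠ ⊤) (h : Disjoint A B) (k : Fin n) :
    indVec n ν (A ∪ B) k = indVec n ν A k + indVec n ν B k := by
  rw [indVec_eq hA hνA, indVec_eq hB hνB,
    indVec_eq (hA.union hB) (measure_union_ne_top hνA hνB)]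
  exact indicatorConstLp_disjoint_union hA hB hνA hνB h _

/-- The half intervals split into their dyadic pieces; `e` is the identity or the reflection. -/
theorem indVec_preimage_cell_eq_sum (ν : Measure ℝ) (k : Fin n) (e : ℝ → ℝ)
    (he : Measurable e) (M : ℕ) (hν : ∀ M m, ν (e ⁻¹' cell M m) ≠ ⊤) :
    indVec n ν (e ⁻¹' cell 0 0) k = ∑ m : Fin (M + 1), indVec n ν (e ⁻¹' cell M m) k := by
  have hm (M m : ℕ) : MeasurableSet (e ⁻¹' cell M m) := he (measurableSet_cell M m)
  induction M with
  | zero => simp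
  | succ M ih =>
    rw [ih, Fin.sum_univ_castSucc, Fin.sum_univ_castSucc, Fin.sum_univ_castSucc, add_assoc]
    simp only [Fin.val_castSucc, Fin.val_last]
    congr 1
    · refine Finset.sum_congr rfl fun m _ => ?_
      have h1 := m.2
      rw [cell, cell, if_pos m.2, if_pos (m.2.trans (Nat.lt_succ_self M))]
    · rw [← indVec_union (hm _ _) (hm _ _) (hν _ _) (hν _ _)
        ((disjoint_cell (Nat.lt_succ_self M) le_rfl).preimage e), ← preimage_union]
      congr 2
      rw [cell, cell, cell, if_neg (lt_irrefl _), if_pos (Nat.lt_succ_self M),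
        if_neg (lt_irrefl _), union_comm]
      exact (Ioc_union_Ioc_eq_Ioc (by positivity) (half_mul_pow_anti (Nat.le_succ M))).symm

/-- The canonical map of `L₂^c(ν₁; ℓ₂ⁿ)` to `G_n`. -/
noncomputable def columnIncl (n : ℕ) : L2 ν₁ n →ₗ[ℂ] G n :=
  (LinearMap.ker (Q n)).mkQ ∘ₗ LinearMap.inl ℂ _ _

/-- The canonical map of `L₂^r(ν₂; ℓ₂ⁿ)` to `G_n`. -/
noncomputable def rowIncl (n : ℕ) : L2 ν₂ n →ₗ[ℂ] G n :=
  (LinearMap.ker (Q n)).mkQ ∘ₗ LinearMap.inr ℂ _ _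

/-- Two pairs represent the same element of `G_n` if and only if the sums of their components agree
almost everywhere. -/
theorem mkQ_eq_mkQ_iff {z w : L2 ν₁ n × L2 ν₂ n} :
    (LinearMap.ker (Q n)).mkQ z = (LinearMap.ker (Q n)).mkQ w ↔
      (fun t => z.1 t + z.2 t) =ᵐ[μ] fun t => w.1 t + w.2 t := by
  rw [Submodule.mkQ_apply, Submodule.mkQ_apply, Submodule.Quotient.eq, LinearMap.mem_ker, map_sub,
    sub_eq_zero]
  have hQ (z : L2 ν₁ n × L2 ν₂ n) : Q n z = AEEqFun.mk (fun t => z.1 t + z.2 t)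
      (((Lp.aestronglyMeasurable z.1).mono_ac μ_ac_ν₁).add
        ((Lp.aestronglyMeasurable z.2).mono_ac μ_ac_ν₂)) := rfl
  rw [hQ, hQ, AEEqFun.mk_eq_mk]

theorem columnIncl_indVec {A : Set ℝ} (hA : MeasurableSet A) (h1 : ν₁ A ≠ ⊤) (h2 : ν₂ A ≠ ⊤)
    (k : Fin n) : columnIncl n (indVec n ν₁ A k) = rowIncl n (indVec n ν₂ A k) := by
  rw [indVec_eq hA h1, indVec_eq hA h2]
  refine mkQ_eq_mkQ_iff.2 ?_
  simp only [LinearMap.inl_apply, LinearMap.inr_apply]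
  filter_upwards [μ_ac_ν₁.ae_le (indicatorConstLp_coeFn (p := 2) (hs := hA) (hμs := h1)
      (c := EuclideanSpace.single k (1 : ℂ))),
    μ_ac_ν₂.ae_le (indicatorConstLp_coeFn (p := 2) (hs := hA) (hμs := h2)
      (c := EuclideanSpace.single k (1 : ℂ))),
    μ_ac_ν₁.ae_le (Lp.coeFn_zero (EuclideanSpace ℂ (Fin n)) 2 ν₁),
    μ_ac_ν₂.ae_le (Lp.coeFn_zero (EuclideanSpace ℂ (Fin n)) 2 ν₂)] with t e1 e2 e3 e4
  rw [e1, e2, e3, e4]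
  simp

/-- `f_k` is represented by `1_{[1/2,1)} e_k` in the column and `1_{(0,1/2]} e_k` in the row
summand; the common point `1/2` is a null set. -/
theorem f_eq (k : Fin n) :
    f n k = rowIncl n (indVec n ν₂ (cell 0 0) k) +
      columnIncl n (indVec n ν₁ ((fun t => 1 - t) ⁻¹' cell 0 0) k) := by
  have hr := measurableSet_preimage_cell 0 0
  have hc := measurableSet_cell 0 0
  rw [indVec_eq hc (ν₂_cell_ne_top 0 0), indVec_eq hr (ν₁_preimage_cell_ne_top 0 0), rowIncl,
    columnIncl, LinearMap.comp_apply, LinearMap.comp_apply, ← map_add]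
  refine mkQ_eq_mkQ_iff.2 ?_
  simp only [LinearMap.inl_apply, LinearMap.inr_apply, Prod.mk_add_mk, zero_add, add_zero]
  have hne : ∀ᵐ t ∂μ, t ≠ (1 / 2 : ℝ) := by
    refine (withDensity_absolutelyContinuous _ _).ae_le (ae_restrict_of_ae ?_)
    exact (Set.finite_singleton (1 / 2 : ℝ)).countable.ae_notMem volume
  filter_upwards [hne, ae_mem_Ioo,
    μ_ac_ν₁.ae_le (indicatorConstLp_coeFn (p := 2) (hs := hr)
      (hμs := ν₁_preimage_cell_ne_top 0 0) (c := EuclideanSpace.single k (1 : ℂ))),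
    μ_ac_ν₂.ae_le (indicatorConstLp_coeFn (p := 2) (hs := hc)
      (hμs := ν₂_cell_ne_top 0 0) (c := EuclideanSpace.single k (1 : ℂ))),
    μ_ac_ν₁.ae_le (memLp_sqrt n k).coeFn_toLp,
    μ_ac_ν₂.ae_le (memLp_one_sub_sqrt n k).coeFn_toLp] with t h1 h2 e1 e2 e3 e4
  rw [e1, e2, e3, e4, ← add_smul]
  have e5 : ((√t : ℝ) : ℂ) + ((1 - √t : ℝ) : ℂ) = 1 := by push_cast; ring
  rw [e5, one_smul]
  have hcell : cell 0 0 = Ioc 0 (1 / 2) := by simp [cell]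
  rw [hcell]
  by_cases ht : t < 1 / 2
  · rw [indicator_of_notMem, indicator_of_mem, zero_add]
    · exact ⟨h2.1, ht.le⟩
    · rintro ⟨-, h⟩
      linarith
  · rw [indicator_of_mem, indicator_of_notMem, add_zero]
    · exact fun h => h1 (le_antisymm h.2 (not_lt.1 ht))
    · exact ⟨by linarith [h2.2], by linarith [not_lt.1 ht]⟩

theorem normsG_nonneg (m : ℕ) (x : Matrix (Fin m) (Fin m) (G n)) : 0 ≤ normsG n m x :=
  quotientNorms_nonneg (l1SumNorms_nonneg _ _) _ m x

theorem normsG_columnIncl_le (m : ℕ) (x : Matrix (Fin m) (Fin m) (L2 ν₁ n)) :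
    normsG n m (x.map (columnIncl n)) ≤ columnNorms _ m x :=
  (quotientNorms_mkQ_le (l1SumNorms_nonneg _ _) _ m (x.map (LinearMap.inl ℂ _ _))).trans
    (l1SumNorms_inl_le _ columnNorms_nonneg m x)

theorem normsG_rowIncl_le (m : ℕ) (x : Matrix (Fin m) (Fin m) (L2 ν₂ n)) :
    normsG n m (x.map (rowIncl n)) ≤ rowNorms _ m x :=
  (quotientNorms_mkQ_le (l1SumNorms_nonneg _ _) _ m (x.map (LinearMap.inr ℂ _ _))).trans
    (l1SumNorms_inr_le _ rowNorms_nonneg m x)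

end CanonicalVectors

/-! ### The upper bound -/

section UpperBound

open Set

variable {n : ℕ}

theorem ν₂_real_cell (M m : ℕ) :
    ν₂.real (cell M m) = ν₁.real ((fun t : ℝ => 1 - t) ⁻¹' cell M m) := by
  rw [measureReal_def, measureReal_def, ν₁_preimage_one_sub (measurableSet_cell M m)]

theorem ν₂_real_preimage_cell (M m : ℕ) :
    ν₂.real ((fun t : ℝ => 1 - t) ⁻¹' cell M m) = ν₁.real (cell M m) := by
  rw [measureReal_def, measureReal_def, ν₂_preimage_one_sub (measurableSet_cell M m)]

theorem ν₁_real_preimage_last_cell_le (M : ℕ) :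
    ν₁.real ((fun t : ℝ => 1 - t) ⁻¹' cell M M) ≤ 4 / Real.pi * (1 / 2) ^ M := by
  refine le_trans ?_ (sum_ν₁_real_preimage_cell_le M M)
  refine le_trans (by simp) (Finset.single_le_sum (fun i _ => ?_) (Finset.mem_univ (Fin.last M)))
  split_ifs
  exacts [measureReal_nonneg, le_rfl]

/-- The sum `∑_{m < M, m ≤ m'} ν₁(L_m) ν₁(1 - L_{m'})` over the dyadic pieces, which is a
discretization of `∫∫ ds dt / (√s √t (s + t))`, grows linearly in `M`. -/
theorem sum_mul_ν₁_real_le (M : ℕ) :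
    ∑ m : Fin (M + 1), ∑ m' : Fin (M + 1), (if (m : ℕ) < M ∧ (m : ℕ) ≤ m' then
      ν₁.real (cell M m) * ν₁.real ((fun t : ℝ => 1 - t) ⁻¹' cell M m') else 0) ≤
      (8 / Real.pi) ^ 2 * M := by
  have hpi := Real.pi_pos
  rw [Fin.sum_univ_castSucc]
  have hlast : ∑ m' : Fin (M + 1), (if ((Fin.last M : Fin (M + 1)) : ℕ) < M ∧
      ((Fin.last M : Fin (M + 1)) : ℕ) ≤ m' then ν₁.real (cell M (Fin.last M : Fin (M + 1))) *
        ν₁.real ((fun t : ℝ => 1 - t) ⁻¹' cell M m') else 0) = 0 :=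
    Finset.sum_eq_zero fun m' _ => if_neg (by simp)
  rw [hlast, add_zero]
  calc _ ≤ ∑ _m : Fin M, (8 / Real.pi) ^ 2 := Finset.sum_le_sum fun m _ => ?_
    _ = _ := by simp [mul_comm]
  simp only [Fin.val_castSucc, m.2, true_and]
  calc _ = ν₁.real (cell M m) * ∑ m' : Fin (M + 1), (if (m : ℕ) ≤ m' then
        ν₁.real ((fun t : ℝ => 1 - t) ⁻¹' cell M m') else 0) := by
        rw [Finset.mul_sum]
        exact Finset.sum_congr rfl fun m' _ => by split_ifs <;> simp
    _ ≤ (16 / Real.pi * 2 ^ (m : ℕ)) * (4 / Real.pi * (1 / 2) ^ (m : ℕ)) :=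
        mul_le_mul (ν₁_real_cell_le m.2) (sum_ν₁_real_preimage_cell_le M m)
          (Finset.sum_nonneg fun i _ => by split_ifs; exacts [measureReal_nonneg, le_rfl])
          (by positivity)
    _ = (8 / Real.pi) ^ 2 * (2 * (1 / 2)) ^ (m : ℕ) := by rw [mul_pow]; ring
    _ = _ := by norm_num

/-- Bookkeeping for the Hilbert–Schmidt norms of `P ⊗ a`, where the relation `P` selects pairs of
pieces. -/
theorem sum_sq_mul_le {κ : Type*} [Fintype κ] (P : κ → κ → Prop) [∀ m m', Decidable (P m m')]
    (a : Matrix (Fin n) (Fin n) ℂ) (U V : κ × Fin n → ℝ) (r s : κ → ℝ) (hV : ∀ b, 0 ≤ V b)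
    (hUr : ∀ b, U b ≤ r b.1) (hVs : ∀ b, V b ≤ s b.1) (hr : ∀ m, 0 ≤ r m) {W : ℝ}
    (hW : ∑ m, ∑ m', (if P m m' then r m * s m' else 0) ≤ W) :
    ∑ b : κ × Fin n, ∑ b' : κ × Fin n,
      ‖if P b.1 b'.1 then a b.2 b'.2 else 0‖ ^ 2 * (U b * V b') ≤
      W * ∑ i, ∑ j, ‖a i j‖ ^ 2 := by
  calc _ ≤ ∑ b : κ × Fin n, ∑ b' : κ × Fin n,
        (if P b.1 b'.1 then r b.1 * s b'.1 else 0) * ‖a b.2 b'.2‖ ^ 2 := by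
        refine Finset.sum_le_sum fun b _ => Finset.sum_le_sum fun b' _ => ?_
        split_ifs
        · rw [mul_comm]
          exact mul_le_mul_of_nonneg_right (mul_le_mul (hUr _) (hVs _) (hV _) (hr _))
            (by positivity)
        · simp
    _ = (∑ m, ∑ m', (if P m m' then r m * s m' else 0)) * ∑ i, ∑ j, ‖a i j‖ ^ 2 := by
        rw [Fintype.sum_prod_type, Fintype.sum_mul_sum]
        refine Finset.sum_congr rfl fun m _ => Finset.sum_congr rfl fun i _ => ?_
        rw [Fintype.sum_prod_type, Fintype.sum_mul_sum]
    _ ≤ _ := mul_le_mul_of_nonneg_right hW (by positivity)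

/-- Hilbert–Schmidt estimate of a block of a form on `L₂^c(ν) × L₂^c(ν)`, summed over the pairs of
pieces selected by `P`. -/
theorem norm_sum_indVec_pieces_le {ν : Measure ℝ} {B : L2 ν n →ₗ[ℂ] L2 ν n →ₗ[ℂ] ℂ}
    (hB : IsJointCompleteContraction (columnNorms _) (columnNorms _) B) {κ : Type*} [Fintype κ]
    (P : κ → κ → Prop) [∀ m m', Decidable (P m m')] {S T : κ → Set ℝ}
    (hS : Pairwise fun m m' => Disjoint (S m) (S m'))
    (hT : Pairwise fun m m' => Disjoint (T m) (T m')) {W : ℝ}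
    (hW : ∑ m, ∑ m', (if P m m' then ν.real (S m) * ν.real (T m') else 0) ≤ W)
    (a : Matrix (Fin n) (Fin n) ℂ) :
    ‖∑ b : κ × Fin n, ∑ b' : κ × Fin n, (if P b.1 b'.1 then a b.2 b'.2 else 0) *
      B (indVec n ν (S b.1) b.2) (indVec n ν (T b'.1) b'.2)‖ ≤
      √(W * ∑ i, ∑ j, ‖a i j‖ ^ 2) := by
  have ho {S : κ → Set ℝ} (hS : Pairwise fun m m' => Disjoint (S m) (S m')) :
      Pairwise fun b b' : κ × Fin n =>
        inner ℂ (indVec n ν (S b.1) b.2) (indVec n ν (S b'.1) b'.2) = 0 := by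
    intro b b' h
    refine inner_indVec ?_
    by_cases h2 : b.2 = b'.2
    · exact Or.inr (hS fun h1 => h (Prod.ext h1 h2))
    · exact Or.inl h2
  refine (norm_sum_le_of_column_column hB (fun b : κ × Fin n => indVec n ν (S b.1) b.2)
    (fun b : κ × Fin n => indVec n ν (T b.1) b.2) (ho hS) (ho hT)
    fun b b' => if P b.1 b'.1 then a b.2 b'.2 else 0).trans ?_
  exact Real.sqrt_le_sqrt (sum_sq_mul_le P a _ _ (fun m => ν.real (S m)) (fun m => ν.real (T m))
    (fun b => sq_nonneg _) (fun b => norm_sq_indVec_le _ _) (fun b => norm_sq_indVec_le _ _)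
    (fun m => measureReal_nonneg) hW)

/-- The pair of the two remainders: here only boundedness is available, and the factor `√n` is
compensated by the measure of the remainder. -/
theorem norm_sum_last_cell_le {B : L2 ν₂ n →ₗ[ℂ] L2 ν₁ n →ₗ[ℂ] ℂ}
    (hB : IsJointCompleteContraction (rowNorms _) (columnNorms _) B) {M : ℕ} (hM : n ≤ 4 ^ M)
    (a : Matrix (Fin n) (Fin n) ℂ) :
    ‖∑ i, ∑ j, a i j * B (indVec n ν₂ (cell M M) i)
      (indVec n ν₁ ((fun t => 1 - t) ⁻¹' cell M M) j)‖ ≤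
      4 / Real.pi * √(∑ i, ∑ j, ‖a i j‖ ^ 2) := by
  have hpi := Real.pi_pos
  set β := ν₁.real ((fun t : ℝ => 1 - t) ⁻¹' cell M M) with hβ
  have hβ0 : 0 ≤ β := measureReal_nonneg
  refine (norm_sum_le_of_bounded hB.norm_le_of_row_column _ _ (Real.sqrt_nonneg β)
    (Real.sqrt_nonneg β) (fun i => Real.le_sqrt_of_sq_le ?_) (fun i => Real.le_sqrt_of_sq_le ?_)
    (fun i j hij => inner_indVec (Or.inl hij)) a).trans ?_
  · exact (norm_sq_indVec_le _ _).trans_eq (ν₂_real_cell M M)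
  · exact norm_sq_indVec_le _ _
  · refine mul_le_mul_of_nonneg_right ?_ (Real.sqrt_nonneg _)
    rw [mul_assoc, Real.mul_self_sqrt hβ0]
    have h1 : √(n : ℝ) ≤ 2 ^ M := by
      refine Real.sqrt_le_iff.2 ⟨by positivity, ?_⟩
      rw [← pow_mul, mul_comm, pow_mul]
      norm_num
      exact_mod_cast hM
    calc √(n : ℝ) * β ≤ 2 ^ M * (4 / Real.pi * (1 / 2) ^ M) :=
          mul_le_mul h1 (ν₁_real_preimage_last_cell_le M) hβ0 (by positivity)
      _ = 4 / Real.pi * (2 * (1 / 2)) ^ M := by rw [mul_pow]; ring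
      _ = _ := by norm_num

/-- In `G_n` a piece can be moved from one summand to the other as long as it has finite norm in
both. So each pair of pieces, other than that of the remainders, may be evaluated on two columns
or on two rows. -/
theorem apply_cell_eq (B : G n →ₗ[ℂ] G n →ₗ[ℂ] ℂ) {M : ℕ} (m m' : Fin (M + 1)) (i j : Fin n)
    (c : ℂ) :
    c * B (rowIncl n (indVec n ν₂ (cell M m) i))
        (columnIncl n (indVec n ν₁ ((fun t => 1 - t) ⁻¹' cell M m') j)) =
      (if (m : ℕ) < M ∧ (m : ℕ) ≤ m' then c else 0) *
        B.compl₁₂ (columnIncl n) (columnIncl n) (indVec n ν₁ (cell M m) i)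
          (indVec n ν₁ ((fun t => 1 - t) ⁻¹' cell M m') j) +
      (if (m' : ℕ) < m then c else 0) *
        B.compl₁₂ (rowIncl n) (rowIncl n) (indVec n ν₂ (cell M m) i)
          (indVec n ν₂ ((fun t => 1 - t) ⁻¹' cell M m') j) +
      (if m = Fin.last M ∧ m' = Fin.last M then
        c * B.compl₁₂ (rowIncl n) (columnIncl n) (indVec n ν₂ (cell M M) i)
          (indVec n ν₁ ((fun t => 1 - t) ⁻¹' cell M M) j) else 0) := by
  simp only [LinearMap.compl₁₂_apply]
  have hm := Nat.lt_succ_iff.1 m.2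
  have hm' := Nat.lt_succ_iff.1 m'.2
  by_cases h1 : (m : ℕ) < M ∧ (m : ℕ) ≤ m'
  · have h2 : ¬(m' : ℕ) < m := by omega
    have h3 : ¬(m = Fin.last M ∧ m' = Fin.last M) := by
      rintro ⟨rfl, -⟩
      exact lt_irrefl _ h1.1
    rw [if_pos h1, if_neg h2, if_neg h3, zero_mul, add_zero, add_zero,
      columnIncl_indVec (measurableSet_cell _ _) (ν₁_cell_ne_top h1.1) (ν₂_cell_ne_top _ _)]
  by_cases h2 : (m' : ℕ) < m
  · have h3 : ¬(m = Fin.last M ∧ m' = Fin.last M) := by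
      rintro ⟨rfl, rfl⟩
      exact lt_irrefl _ h2
    rw [if_neg h1, if_pos h2, if_neg h3, zero_mul, add_zero, zero_add,
      columnIncl_indVec (measurableSet_preimage_cell _ _) (ν₁_preimage_cell_ne_top _ _)
        (ν₂_preimage_cell_ne_top (h2.trans_le hm))]
  · have h3 : m = Fin.last M ∧ m' = Fin.last M := by
      constructor <;> rw [Fin.ext_iff, Fin.val_last] <;> omega
    rw [if_neg h1, if_neg h2, if_pos h3, zero_mul, zero_mul, zero_add, zero_add, h3.1, h3.2,
      Fin.val_last]

/-- The part of `∑ a_{ij} B(f_i, f_j)` in which `f_i` is restricted to `(0, 1/2]` and `f_j` to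
`[1/2, 1)`. Pairs `(m, m')` of dyadic pieces are estimated in Hilbert–Schmidt norm, by the column
structures if `m ≤ m'` and by the row structures if `m' < m`; the pair of the two remainders is
estimated by the boundedness of the mixed block. -/
theorem norm_sum_row_column_le {B : G n →ₗ[ℂ] G n →ₗ[ℂ] ℂ}
    (hB : IsJointCompleteContraction (normsG n) (normsG n) B) {M : ℕ} (hM : n ≤ 4 ^ M)
    (a : Matrix (Fin n) (Fin n) ℂ) :
    ‖∑ i, ∑ j, a i j * B (rowIncl n (indVec n ν₂ (cell 0 0) i))
        (columnIncl n (indVec n ν₁ ((fun t => 1 - t) ⁻¹' cell 0 0) j))‖ ≤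
      (16 * √M + 4) / Real.pi * √(∑ i, ∑ j, ‖a i j‖ ^ 2) := by
  have hpi := Real.pi_pos
  have hBcc := hB.compl₁₂ normsG_nonneg columnNorms_nonneg _ _ (normsG_columnIncl_le (n := n))
    (normsG_columnIncl_le (n := n))
  have hBrr := isJointCompleteContraction_row_row_iff.1 (hB.compl₁₂ normsG_nonneg rowNorms_nonneg
    _ _ (normsG_rowIncl_le (n := n)) (normsG_rowIncl_le (n := n)))
  have hBrc := hB.compl₁₂ normsG_nonneg rowNorms_nonneg _ _ (normsG_rowIncl_le (n := n))
    (normsG_columnIncl_le (n := n))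
  have hexp : ∑ i, ∑ j, a i j * B (rowIncl n (indVec n ν₂ (cell 0 0) i))
        (columnIncl n (indVec n ν₁ ((fun t => 1 - t) ⁻¹' cell 0 0) j)) =
      ∑ b : Fin (M + 1) × Fin n, ∑ b' : Fin (M + 1) × Fin n,
        a b.2 b'.2 * B (rowIncl n (indVec n ν₂ (cell M b.1) b.2))
          (columnIncl n (indVec n ν₁ ((fun t => 1 - t) ⁻¹' cell M b'.1) b'.2)) := by
    rw [Fintype.sum_prod_type_right]
    refine Finset.sum_congr rfl fun i _ => ?_
    simp_rw [Fintype.sum_prod_type_right]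
    rw [Finset.sum_comm]
    refine Finset.sum_congr rfl fun j _ => ?_
    have e1 := indVec_preimage_cell_eq_sum ν₂ i id measurable_id M ν₂_cell_ne_top
    have e2 := indVec_preimage_cell_eq_sum ν₁ j (fun t => 1 - t) (by fun_prop) M
      ν₁_preimage_cell_ne_top
    simp only [preimage_id] at e1
    rw [e1, e2]
    simp only [map_sum, LinearMap.sum_apply, Finset.mul_sum]
    exact Finset.sum_comm
  have hT : Pairwise fun m m' : Fin (M + 1) =>
      Disjoint ((fun t : ℝ => 1 - t) ⁻¹' cell M m) ((fun t : ℝ => 1 - t) ⁻¹' cell M m') :=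
    fun m m' h => (pairwise_disjoint_cell M h).preimage _
  have hsqrt : √((8 / Real.pi) ^ 2 * M * ∑ i, ∑ j, ‖a i j‖ ^ 2) =
      8 / Real.pi * √M * √(∑ i, ∑ j, ‖a i j‖ ^ 2) := by
    rw [Real.sqrt_mul (by positivity), Real.sqrt_mul (by positivity),
      Real.sqrt_sq (by positivity)]
  have hb₁ := norm_sum_indVec_pieces_le hBcc
    (fun m m' : Fin (M + 1) => (m : ℕ) < M ∧ (m : ℕ) ≤ m') (pairwise_disjoint_cell M) hT
    (sum_mul_ν₁_real_le M) a
  have hb₂ := norm_sum_indVec_pieces_le hBrr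
    (fun m m' : Fin (M + 1) => (m' : ℕ) < m) (pairwise_disjoint_cell M) hT
    (W := (8 / Real.pi) ^ 2 * M) (by
      refine le_trans ?_ (sum_mul_ν₁_real_le M)
      rw [Finset.sum_comm]
      refine Finset.sum_le_sum fun m' _ => Finset.sum_le_sum fun m _ => ?_
      rw [ν₂_real_cell, ν₂_real_preimage_cell, mul_comm]
      have := Nat.lt_succ_iff.1 m.2
      split_ifs with h1 h2 h2
      · exact le_rfl
      · omega
      · exact mul_nonneg measureReal_nonneg measureReal_nonneg
      · exact le_rfl) a
  have hb₃ := norm_sum_last_cell_le hBrc hM a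
  rw [hsqrt] at hb₁ hb₂
  rw [hexp]
  simp only [apply_cell_eq, Finset.sum_add_distrib]
  have e : ∀ F : Fin n → Fin n → ℂ, ∑ b : Fin (M + 1) × Fin n, ∑ b' : Fin (M + 1) × Fin n,
      (if b.1 = Fin.last M ∧ b'.1 = Fin.last M then F b.2 b'.2 else 0) = ∑ i, ∑ j, F i j := by
    intro F
    rw [Fintype.sum_prod_type, Finset.sum_eq_single (Fin.last M)
      (fun m _ hm => by simp [hm]) (by simp)]
    refine Finset.sum_congr rfl fun i _ => ?_
    rw [Fintype.sum_prod_type, Finset.sum_eq_single (Fin.last M)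
      (fun m _ hm => by simp [hm]) (by simp)]
    simp
  rw [e fun i j => a i j * B.compl₁₂ (rowIncl n) (columnIncl n) (indVec n ν₂ (cell M M) i)
    (indVec n ν₁ ((fun t => 1 - t) ⁻¹' cell M M) j)]
  refine (norm_add₃_le.trans (add_le_add_three hb₁ hb₂ hb₃)).trans_eq ?_
  ring

/-- The parts of `∑ a_{ij} B(f_i, f_j)` in which both vectors are restricted to the same half of
the interval are estimated in Hilbert–Schmidt norm. -/
theorem norm_sum_indVec_le {ν : Measure ℝ} {B : L2 ν n →ₗ[ℂ] L2 ν n →ₗ[ℂ] ℂ}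
    (hB : IsJointCompleteContraction (columnNorms _) (columnNorms _) B) (S : Set ℝ)
    (a : Matrix (Fin n) (Fin n) ℂ) :
    ‖∑ i, ∑ j, a i j * B (indVec n ν S i) (indVec n ν S j)‖ ≤
      ν.real S * √(∑ i, ∑ j, ‖a i j‖ ^ 2) := by
  have ho : Pairwise fun i j : Fin n => inner ℂ (indVec n ν S i) (indVec n ν S j) = 0 :=
    fun i j h => inner_indVec (Or.inl h)
  refine (norm_sum_le_of_column_column hB _ _ ho ho fun i j => a i j).trans ?_
  have h0 : 0 ≤ ν.real S := measureReal_nonneg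
  conv_rhs => rw [← Real.sqrt_sq h0]
  rw [← Real.sqrt_mul (sq_nonneg _)]
  refine Real.sqrt_le_sqrt ?_
  rw [Finset.mul_sum]
  refine Finset.sum_le_sum fun i _ => ?_
  rw [Finset.mul_sum]
  refine Finset.sum_le_sum fun j _ => ?_
  rw [mul_comm, sq (ν.real S)]
  gcongr
  exacts [norm_sq_indVec_le _ _, norm_sq_indVec_le _ _]

theorem norm_sum_f_le {B : G n →ₗ[ℂ] G n →ₗ[ℂ] ℂ}
    (hB : IsJointCompleteContraction (normsG n) (normsG n) B) {M : ℕ} (hM : n ≤ 4 ^ M)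
    (a : Matrix (Fin n) (Fin n) ℂ) :
    ‖∑ i, ∑ j, a i j * B (f n i) (f n j)‖ ≤
      (32 * √M + 16) / Real.pi * √(∑ i, ∑ j, ‖a i j‖ ^ 2) := by
  have hBcc := hB.compl₁₂ normsG_nonneg columnNorms_nonneg _ _ (normsG_columnIncl_le (n := n))
    (normsG_columnIncl_le (n := n))
  have hBrr := isJointCompleteContraction_row_row_iff.1 (hB.compl₁₂ normsG_nonneg rowNorms_nonneg
    _ _ (normsG_rowIncl_le (n := n)) (normsG_rowIncl_le (n := n)))
  set A := √(∑ i, ∑ j, ‖a i j‖ ^ 2) with hA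
  have hA0 : 0 ≤ A := Real.sqrt_nonneg _
  have h4 : ν₁.real ((fun t : ℝ => 1 - t) ⁻¹' cell 0 0) ≤ 4 / Real.pi := by
    simpa using ν₁_real_preimage_last_cell_le 0
  have h1 := (norm_sum_indVec_le hBrr (cell 0 0) a).trans
    (mul_le_mul_of_nonneg_right ((ν₂_real_cell 0 0).trans_le h4) hA0)
  have h2 := (norm_sum_indVec_le hBcc ((fun t : ℝ => 1 - t) ⁻¹' cell 0 0) a).trans
    (mul_le_mul_of_nonneg_right h4 hA0)
  have h3 := norm_sum_row_column_le hB hM a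
  have h5 := norm_sum_row_column_le hB.flip hM a.transpose
  simp only [Matrix.transpose_apply, LinearMap.flip_apply] at h5
  rw [Finset.sum_comm, Finset.sum_comm (f := fun i j => ‖a j i‖ ^ 2)] at h5
  simp only [LinearMap.compl₁₂_apply] at h1 h2
  have e : ∑ i, ∑ j, a i j * B (f n i) (f n j) =
      ∑ i, ∑ j, a i j * B (rowIncl n (indVec n ν₂ (cell 0 0) i))
        (rowIncl n (indVec n ν₂ (cell 0 0) j)) +
      ∑ i, ∑ j, a i j * B (columnIncl n (indVec n ν₁ ((fun t => 1 - t) ⁻¹' cell 0 0) i))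
        (columnIncl n (indVec n ν₁ ((fun t => 1 - t) ⁻¹' cell 0 0) j)) +
      (∑ i, ∑ j, a i j * B (rowIncl n (indVec n ν₂ (cell 0 0) i))
        (columnIncl n (indVec n ν₁ ((fun t => 1 - t) ⁻¹' cell 0 0) j)) +
      ∑ i, ∑ j, a i j * B (columnIncl n (indVec n ν₁ ((fun t => 1 - t) ⁻¹' cell 0 0) i))
        (rowIncl n (indVec n ν₂ (cell 0 0) j))) := by
    simp only [← Finset.sum_add_distrib]
    refine Finset.sum_congr rfl fun i _ => Finset.sum_congr rfl fun j _ => ?_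
    rw [f_eq, f_eq]
    simp only [map_add, LinearMap.add_apply]
    ring
  rw [e]
  refine (norm_add_le_of_le (norm_add_le_of_le h1 h2) (norm_add_le_of_le h3 h5)).trans_eq ?_
  ring

/-- The number of dyadic scales between `1/n` and `1` is comparable to `1 + ln n`. -/
theorem exists_dyadic_scale (hn : 1 ≤ n) : ∃ M : ℕ, 1 ≤ M ∧ n ≤ 4 ^ M ∧ 4 ^ (M - 1) ≤ n ∧
    (M : ℝ) ≤ 1 + Real.log n ∧ 1 + Real.log n ≤ 3 * M := by
  refine ⟨Nat.log 4 n + 1, by omega, (Nat.lt_pow_succ_log_self (by norm_num) n).le,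
    Nat.pow_log_le_self 4 (by omega), ?_, ?_⟩
  · have h := Nat.pow_log_le_self 4 (by omega : n ≠ 0)
    have h1 : ((4 : ℝ) ^ Nat.log 4 n) ≤ n := by exact_mod_cast h
    have h2 := Real.log_le_log (by positivity) h1
    rw [Real.log_pow, show (4 : ℝ) = 2 ^ 2 by norm_num, Real.log_pow] at h2
    push_cast at h2 ⊢
    have := Real.log_two_gt_d9
    nlinarith [(Nat.cast_nonneg (Nat.log 4 n) : (0 : ℝ) ≤ _)]
  · have h := (Nat.lt_pow_succ_log_self (by norm_num : 1 < 4) n).le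
    have h1 : (n : ℝ) ≤ (4 : ℝ) ^ (Nat.log 4 n + 1) := by exact_mod_cast h
    have h2 := Real.log_le_log (by exact_mod_cast hn) h1
    rw [Real.log_pow, show (4 : ℝ) = 2 ^ 2 by norm_num, Real.log_pow] at h2
    push_cast at h2 ⊢
    have := Real.log_two_lt_d9
    nlinarith [(Nat.cast_nonneg (Nat.log 4 n) : (0 : ℝ) ≤ _)]

theorem projectiveNorm_sum_f_le (hn : 1 ≤ n) (a : Matrix (Fin n) (Fin n) ℂ) :
    projectiveNorm (normsG n) (normsG n) (∑ i, ∑ j, a i j • (f n i ⊗ₜ[ℂ] f n j)) ≤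
      16 * √(1 + Real.log n) * √(∑ i, ∑ j, ‖a i j‖ ^ 2) := by
  obtain ⟨M, hM1, hM, -, hMlog, -⟩ := exists_dyadic_scale hn
  refine Real.sSup_le ?_ (by positivity)
  rintro r ⟨B, hB, rfl⟩
  have h := norm_sum_f_le hB hM a
  have e : TensorProduct.lift B (∑ i, ∑ j, a i j • (f n i ⊗ₜ[ℂ] f n j)) =
      ∑ i, ∑ j, a i j * B (f n i) (f n j) := by
    simp only [map_sum, map_smul, TensorProduct.lift.tmul, smul_eq_mul]
  rw [e]
  refine h.trans (mul_le_mul_of_nonneg_right ?_ (Real.sqrt_nonneg _))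
  have h1 : √(M : ℝ) ≤ √(1 + Real.log n) := Real.sqrt_le_sqrt hMlog
  have h2 : 1 ≤ √(M : ℝ) := Real.one_le_sqrt.2 (by exact_mod_cast hM1)
  rw [div_le_iff₀ Real.pi_pos]
  nlinarith [Real.pi_gt_three]

end UpperBound

/-! ### The lower bound -/

section WeightedDiagonalForms

variable {H K : Type*} [NormedAddCommGroup H] [InnerProductSpace ℂ H]
  [NormedAddCommGroup K] [InnerProductSpace ℂ K] {γ : Type*} [Fintype γ]

theorem norm_sq_inv_sqrt_smul {p : ℝ} (hp : 0 < p) (z : ℂ) :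
    ‖((√p)⁻¹ : ℂ) * z‖ ^ 2 = ‖z‖ ^ 2 / p := by
  rw [norm_mul, mul_pow, norm_inv, Complex.norm_real, Real.norm_of_nonneg (Real.sqrt_nonneg _),
    inv_pow, Real.sq_sqrt hp.le]
  ring

theorem mul_mul_eq_normalized {p q : ℝ} (hp : 0 < p) (hq : 0 < q) (c : ℝ) (z w : ℂ) :
    (c : ℂ) * z * w = ((c * √p * √q : ℝ) : ℂ) * (((√p)⁻¹ : ℂ) * z) * (((√q)⁻¹ : ℂ) * w) := by
  have h1 : ((√p : ℝ) : ℂ) ≠ 0 := by simpa using (Real.sqrt_pos.2 hp).ne'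
  have h2 : ((√q : ℝ) : ℂ) ≠ 0 := by simpa using (Real.sqrt_pos.2 hq).ne'
  push_cast
  field_simp

theorem norm_sq_coeff {p q : ℝ} (hp : 0 < p) (hq : 0 < q) (c : ℝ) :
    ‖((c * √p * √q : ℝ) : ℂ)‖ ^ 2 = c ^ 2 * (p * q) := by
  rw [Complex.norm_real, Real.norm_eq_abs, sq_abs, mul_pow, mul_pow, Real.sq_sqrt hp.le,
    Real.sq_sqrt hq.le, mul_assoc]

/-- Diagonal Hilbert–Schmidt forms with respect to two weighted Bessel sequences. -/
theorem isJointCompleteContraction_column_column_weighted {Φ : γ → H →ₗ[ℂ] ℂ} {Ψ : γ → K →ₗ[ℂ] ℂ}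
    {c p q : γ → ℝ} (hp : ∀ g, 0 < p g) (hq : ∀ g, 0 < q g)
    (hΦ : ∀ x, ∑ g, ‖Φ g x‖ ^ 2 / p g ≤ ‖x‖ ^ 2) (hΨ : ∀ y, ∑ g, ‖Ψ g y‖ ^ 2 / q g ≤ ‖y‖ ^ 2)
    (hc : ∑ g, c g ^ 2 * (p g * q g) ≤ 1) {B : H →ₗ[ℂ] K →ₗ[ℂ] ℂ}
    (hB : ∀ x y, B x y = ∑ g, (c g : ℂ) * Φ g x * Ψ g y) :
    IsJointCompleteContraction (columnNorms H) (columnNorms K) B := by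
  refine isJointCompleteContraction_column_column (fun g => ((√(p g))⁻¹ : ℂ) • Φ g)
    (fun g => ((√(q g))⁻¹ : ℂ) • Ψ g) (fun g => ((c g * √(p g) * √(q g) : ℝ) : ℂ)) (fun x => ?_)
    (fun g y => ?_) ?_ fun x y => ?_
  · simpa only [LinearMap.smul_apply, smul_eq_mul, norm_sq_inv_sqrt_smul (hp _)] using hΦ x
  · refine le_of_sq_le_sq ?_ (norm_nonneg _)
    rw [LinearMap.smul_apply, smul_eq_mul, norm_sq_inv_sqrt_smul (hq _)]
    exact (Finset.single_le_sum (f := fun g => ‖Ψ g y‖ ^ 2 / q g)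
      (fun g _ => div_nonneg (sq_nonneg _) (hq g).le) (Finset.mem_univ g)).trans (hΨ y)
  · simpa only [norm_sq_coeff (hp _) (hq _)] using hc
  · rw [hB]
    exact Finset.sum_congr rfl fun g _ => mul_mul_eq_normalized (hp g) (hq g) _ _ _

/-- Bounded diagonal forms with respect to two weighted Bessel sequences. -/
theorem norm_le_of_weighted {Φ : γ → H →ₗ[ℂ] ℂ} {Ψ : γ → K →ₗ[ℂ] ℂ}
    {c p q : γ → ℝ} (hp : ∀ g, 0 < p g) (hq : ∀ g, 0 < q g)
    (hΦ : ∀ x, ∑ g, ‖Φ g x‖ ^ 2 / p g ≤ ‖x‖ ^ 2) (hΨ : ∀ y, ∑ g, ‖Ψ g y‖ ^ 2 / q g ≤ ‖y‖ ^ 2)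
    (hc : ∀ g, c g ^ 2 * (p g * q g) ≤ 1) {B : H →ₗ[ℂ] K →ₗ[ℂ] ℂ}
    (hB : ∀ x y, B x y = ∑ g, (c g : ℂ) * Φ g x * Ψ g y) (x : H) (y : K) :
    ‖B x y‖ ≤ ‖x‖ * ‖y‖ := by
  have h1 (g : γ) : ‖((c g * √(p g) * √(q g) : ℝ) : ℂ)‖ ≤ 1 := by
    refine le_of_sq_le_sq ?_ zero_le_one
    rw [norm_sq_coeff (hp g) (hq g), one_pow]
    exact hc g
  calc ‖B x y‖ ≤ ∑ g, ‖((√(p g))⁻¹ : ℂ) * Φ g x‖ * ‖((√(q g))⁻¹ : ℂ) * Ψ g y‖ := by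
        rw [hB]
        refine (norm_sum_le _ _).trans (Finset.sum_le_sum fun g _ => ?_)
        rw [mul_mul_eq_normalized (hp g) (hq g), norm_mul, norm_mul]
        gcongr
        exact mul_le_of_le_one_left (norm_nonneg _) (h1 g)
    _ ≤ √(∑ g, ‖((√(p g))⁻¹ : ℂ) * Φ g x‖ ^ 2) * √(∑ g, ‖((√(q g))⁻¹ : ℂ) * Ψ g y‖ ^ 2) :=
        Real.sum_mul_le_sqrt_mul_sqrt _ _ _
    _ ≤ √(‖x‖ ^ 2) * √(‖y‖ ^ 2) := by
        simp only [norm_sq_inv_sqrt_smul (hp _), norm_sq_inv_sqrt_smul (hq _)]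
        gcongr
        exacts [hΦ x, hΨ y]
    _ = _ := by rw [Real.sqrt_sq (norm_nonneg _), Real.sqrt_sq (norm_nonneg _)]

end WeightedDiagonalForms

section IntegralFunctionals

open Set

variable {n : ℕ} {ν : Measure ℝ}

theorem memLp_coord (h : μ ≤ ν) (f : L2 ν n) (i : Fin n) : MemLp (fun t => f t i) 2 μ :=
  ((Lp.memLp f).mono_measure h).continuousLinearMap_comp
    (EuclideanSpace.proj i : EuclideanSpace ℂ (Fin n) →L[ℂ] ℂ)

theorem integrable_coord (h : μ ≤ ν) (f : L2 ν n) (i : Fin n) :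
    Integrable (fun t => f t i) μ :=
  (memLp_coord h f i).integrable (by norm_num)

/-- The functional `f ↦ ∫_A f_i dμ` on `L₂(ν; ℓ₂ⁿ)`, for `μ ≤ ν`. -/
noncomputable def integralCoord (h : μ ≤ ν) (A : Set ℝ) (i : Fin n) : L2 ν n →ₗ[ℂ] ℂ where
  toFun f := ∫ t in A, f t i ∂μ
  map_add' f g := by
    rw [← integral_add (integrable_coord h f i).integrableOn (integrable_coord h g i).integrableOn]
    refine integral_congr_ae (ae_restrict_of_ae ?_)
    filter_upwards [h.absolutelyContinuous.ae_le (Lp.coeFn_add f g)] with t ht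
    rw [ht]
    rfl
  map_smul' c f := by
    rw [RingHom.id_apply, smul_eq_mul, ← integral_const_mul]
    refine integral_congr_ae (ae_restrict_of_ae ?_)
    filter_upwards [h.absolutelyContinuous.ae_le (Lp.coeFn_smul c f)] with t ht
    rw [ht]
    rfl

/-- The Cauchy–Schwarz inequality on a finite measure space. -/
theorem sq_norm_integral_le {ρ : Measure ℝ} [IsFiniteMeasure ρ] {g : ℝ → ℂ} (hg : MemLp g 2 ρ) :
    ‖∫ t, g t ∂ρ‖ ^ 2 ≤ ρ.real univ * ∫ t, ‖g t‖ ^ 2 ∂ρ := by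
  rcases eq_or_ne ρ 0 with rfl | h0
  · simp
  have hw : 0 < ρ.real univ := by
    have : NeZero ρ := ⟨h0⟩
    exact measureReal_univ_pos
  set w := ρ.real univ
  set I := ∫ t, ‖g t‖ ∂ρ with hI
  have h1 : Integrable (fun t => ‖g t‖) ρ := (hg.integrable (by norm_num)).norm
  have h2 : Integrable (fun t => ‖g t‖ ^ 2) ρ := (memLp_two_iff_integrable_sq_norm hg.1).1 hg
  -- The variance of `‖g‖` is nonnegative.
  have h3 : 0 ≤ ∫ t, (w * ‖g t‖ - I) ^ 2 ∂ρ := integral_nonneg fun t => sq_nonneg _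
  have h4 : ∫ t, (w * ‖g t‖ - I) ^ 2 ∂ρ = w * (w * ∫ t, ‖g t‖ ^ 2 ∂ρ - I ^ 2) := by
    have : ∀ t, (w * ‖g t‖ - I) ^ 2 = w ^ 2 * ‖g t‖ ^ 2 - 2 * w * I * ‖g t‖ + I ^ 2 :=
      fun t => by ring
    simp only [this]
    have h5 : Integrable (fun t => w ^ 2 * ‖g t‖ ^ 2 - 2 * w * I * ‖g t‖) ρ :=
      (h2.const_mul _).sub (h1.const_mul _)
    rw [integral_add h5 (integrable_const _),
      integral_sub (h2.const_mul _) (h1.const_mul _), integral_const_mul, integral_const_mul,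
      integral_const, smul_eq_mul]
    ring
  rw [h4] at h3
  have h5 : I ^ 2 ≤ w * ∫ t, ‖g t‖ ^ 2 ∂ρ := by
    have := nonneg_of_mul_nonneg_right h3 hw
    linarith
  exact (pow_le_pow_left₀ (norm_nonneg _) (norm_integral_le_integral_norm _) 2).trans h5

theorem norm_sq_eq_integral (f : L2 ν n) : ‖f‖ ^ 2 = ∫ t, ‖f t‖ ^ 2 ∂ν := by
  have h := inner_self_eq_norm_sq_to_K (𝕜 := ℂ) f
  rw [L2.inner_def] at h
  have h1 : ∀ t, inner ℂ (f t) (f t) = ((‖f t‖ ^ 2 : ℝ) : ℂ) := fun t => by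
    rw [inner_self_eq_norm_sq_to_K]
    push_cast
    rfl
  simp only [h1] at h
  have h2 : ∫ t, ((‖f t‖ ^ 2 : ℝ) : ℂ) ∂ν = ((∫ t, ‖f t‖ ^ 2 ∂ν : ℝ) : ℂ) := integral_ofReal
  exact Complex.ofReal_injective ((Complex.ofReal_pow _ _).trans (h2.symm.trans h).symm)

/-- The integrals over disjoint sets on which `μ ≤ K ν` form a weighted Bessel sequence. -/
theorem sum_norm_sq_integralCoord_le (h : μ ≤ ν) {M : ℕ} {A : Fin M → Set ℝ}
    (hA : ∀ m, MeasurableSet (A m)) (hdisj : Pairwise fun m m' => Disjoint (A m) (A m'))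
    {K : Fin M → ℝ} (hK : ∀ m, 0 < K m)
    (hKν : ∀ m s, MeasurableSet s → s ⊆ A m → μ s ≤ ENNReal.ofReal (K m) * ν s)
    (hw : ∀ m, 0 < μ.real (A m)) (f : L2 ν n) :
    ∑ b : Fin M × Fin n, ‖integralCoord h (A b.1) b.2 f‖ ^ 2 / (K b.1 * μ.real (A b.1)) ≤
      ‖f‖ ^ 2 := by
  have hf2 : Integrable (fun t => ‖f t‖ ^ 2) ν :=
    (memLp_two_iff_integrable_sq_norm (Lp.memLp f).1).1 (Lp.memLp f)
  have key (m : Fin M) : ∑ i, ‖integralCoord h (A m) i f‖ ^ 2 / (K m * μ.real (A m)) ≤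
      ∫ t in A m, ‖f t‖ ^ 2 ∂ν := by
    rw [← Finset.sum_div, div_le_iff₀ (mul_pos (hK m) (hw m))]
    have hle : μ.restrict (A m) ≤ ENNReal.ofReal (K m) • ν.restrict (A m) := by
      refine Measure.le_iff.2 fun s hs => ?_
      rw [Measure.restrict_apply hs, Measure.smul_apply, Measure.restrict_apply hs, smul_eq_mul]
      exact hKν m _ (hs.inter (hA m)) inter_subset_right
    calc ∑ i, ‖integralCoord h (A m) i f‖ ^ 2
        ≤ ∑ i, μ.real (A m) * ∫ t in A m, ‖f t i‖ ^ 2 ∂μ := by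
          refine Finset.sum_le_sum fun i _ => ?_
          have := sq_norm_integral_le (ρ := μ.restrict (A m))
            ((memLp_coord h f i).restrict (A m))
          rwa [measureReal_restrict_apply_univ] at this
      _ = μ.real (A m) * ∫ t in A m, ‖f t‖ ^ 2 ∂μ := by
          rw [← Finset.mul_sum, ← integral_finsetSum]
          · simp only [EuclideanSpace.norm_sq_eq]
          · intro i _
            exact ((memLp_two_iff_integrable_sq_norm (memLp_coord h f i).1).1
              (memLp_coord h f i)).integrableOn
      _ ≤ μ.real (A m) * ∫ t, ‖f t‖ ^ 2 ∂(ENNReal.ofReal (K m) • ν.restrict (A m)) := by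
          refine mul_le_mul_of_nonneg_left (integral_mono_measure hle
            (Filter.Eventually.of_forall fun t => sq_nonneg _) ?_) (hw m).le
          exact hf2.integrableOn.smul_measure ENNReal.ofReal_ne_top
      _ = _ := by
          rw [integral_smul_measure, ENNReal.toReal_ofReal (hK m).le, smul_eq_mul]
          ring
  rw [Fintype.sum_prod_type, norm_sq_eq_integral]
  calc _ ≤ ∑ m, ∫ t in A m, ‖f t‖ ^ 2 ∂ν := Finset.sum_le_sum fun m _ => key m
    _ = ∫ t in ⋃ m, A m, ‖f t‖ ^ 2 ∂ν :=
        (integral_iUnion_fintype hA hdisj fun m => hf2.integrableOn).symm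
    _ ≤ _ := setIntegral_le_integral hf2 (Filter.Eventually.of_forall fun t => sq_nonneg _)

theorem μ_le_mul_ν₁ {s : Set ℝ} (hs : MeasurableSet s) {c : ℝ} (h : s ⊆ Iic c) :
    μ s ≤ ENNReal.ofReal c * ν₁ s := by
  rw [ν₁, withDensity_apply _ hs, ← lintegral_const_mul _ (by fun_prop), ← setLIntegral_one]
  refine lintegral_mono_ae ?_
  filter_upwards [ae_restrict_of_ae ae_mem_Ioo, ae_restrict_mem hs] with t ht hts
  have hc : t ≤ c := h hts
  rw [← ENNReal.ofReal_mul (ht.1.le.trans hc)]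
  exact ENNReal.one_le_ofReal.2 ((le_mul_inv_iff₀ ht.1).2 (by simpa using hc))

theorem μ_le_mul_ν₂ {s : Set ℝ} (hs : MeasurableSet s) {c : ℝ}
    (h : s ⊆ (fun t => 1 - t) ⁻¹' Iic c) : μ s ≤ ENNReal.ofReal c * ν₂ s := by
  have hm : Measurable fun t : ℝ => 1 - t := by fun_prop
  rw [← ν₁_preimage_one_sub hs, ← measurePreserving_one_sub.measure_preimage hs.nullMeasurableSet]
  refine μ_le_mul_ν₁ (hm hs) fun t ht => ?_
  have h1 : 1 - (1 - t) ≤ c := h ht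
  exact mem_Iic.2 (by linarith)

/-- The functional on `G_n` induced by `(f, g) ↦ ∫_A (f + g)_i dμ`. -/
noncomputable def integralG (n : ℕ) (A : Set ℝ) (i : Fin n) : G n →ₗ[ℂ] ℂ :=
  (LinearMap.ker (Q n)).liftQ
    ((integralCoord μ_le_ν₁ A i).coprod (integralCoord μ_le_ν₂ A i)) (by
      intro z hz
      have h0 : (LinearMap.ker (Q n)).mkQ z = (LinearMap.ker (Q n)).mkQ 0 := by
        rw [map_zero]
        exact (Submodule.Quotient.mk_eq_zero _).2 hz
      rw [LinearMap.mem_ker, LinearMap.coprod_apply]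
      change ∫ t in A, z.1 t i ∂μ + ∫ t in A, z.2 t i ∂μ = 0
      rw [← integral_add (integrable_coord μ_le_ν₁ z.1 i).integrableOn
        (integrable_coord μ_le_ν₂ z.2 i).integrableOn]
      refine integral_eq_zero_of_ae (ae_restrict_of_ae ?_)
      filter_upwards [mkQ_eq_mkQ_iff.1 h0, μ_ac_ν₁.ae_le (Lp.coeFn_zero
        (EuclideanSpace ℂ (Fin n)) 2 ν₁), μ_ac_ν₂.ae_le (Lp.coeFn_zero
        (EuclideanSpace ℂ (Fin n)) 2 ν₂)] with t ht h1 h2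
      have h3 : z.1 t + z.2 t = 0 := ht.trans ((congrArg₂ (· + ·) h1 h2).trans (add_zero _))
      exact congrArg (fun v : EuclideanSpace ℂ (Fin n) => v i) h3)

theorem integralG_f {A : Set ℝ} (i k : Fin n) :
    integralG n A i (f n k) = if i = k then ((μ.real A : ℝ) : ℂ) else 0 := by
  change ∫ t in A, (memLp_sqrt n k).toLp _ t i ∂μ +
    ∫ t in A, (memLp_one_sub_sqrt n k).toLp _ t i ∂μ = _
  rw [← integral_add (integrable_coord μ_le_ν₁ _ i).integrableOn
    (integrable_coord μ_le_ν₂ _ i).integrableOn]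
  have h : ∫ t in A, ((memLp_sqrt n k).toLp _ t i + (memLp_one_sub_sqrt n k).toLp _ t i) ∂μ =
      ∫ t in A, (if i = k then (1 : ℂ) else 0) ∂μ := by
    refine integral_congr_ae (ae_restrict_of_ae ?_)
    filter_upwards [μ_ac_ν₁.ae_le (memLp_sqrt n k).coeFn_toLp,
      μ_ac_ν₂.ae_le (memLp_one_sub_sqrt n k).coeFn_toLp] with t h1 h2
    rw [h1, h2, ← PiLp.add_apply, ← add_smul]
    have e5 : ((√t : ℝ) : ℂ) + ((1 - √t : ℝ) : ℂ) = 1 := by push_cast; ring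
    rw [e5, one_smul]
    simp
  rw [h]
  split_ifs <;> simp

end IntegralFunctionals

section LowerBound

open Set

variable {n : ℕ}

/-- The interval `(4^{-m-1}, 4^{-m}]`. -/
def dyadicIoc (m : ℕ) : Set ℝ := Ioc ((1 / 4) ^ (m + 1)) ((1 / 4) ^ m)

theorem measurableSet_dyadicIoc (m : ℕ) : MeasurableSet (dyadicIoc m) := measurableSet_Ioc

theorem measurableSet_preimage_dyadicIoc (m : ℕ) :
    MeasurableSet ((fun t : ℝ => 1 - t) ⁻¹' dyadicIoc m) :=
  (by fun_prop : Measurable fun t : ℝ => 1 - t) (measurableSet_dyadicIoc m)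

theorem pairwise_disjoint_dyadicIoc (M : ℕ) :
    Pairwise fun m m' : Fin M => Disjoint (dyadicIoc m) (dyadicIoc m') := by
  have h {m m' : ℕ} (h : m < m') : Disjoint (dyadicIoc m) (dyadicIoc m') := by
    refine Set.disjoint_left.2 fun t ht ht' => ?_
    exact absurd (ht.1.trans_le ht'.2)
      (not_lt.2 (pow_le_pow_of_le_one (by norm_num) (by norm_num) h))
  intro m m' hne
  rcases lt_or_gt_of_ne hne with hlt | hlt
  exacts [h hlt, (h hlt).symm]

theorem μ_real_dyadicIoc_pos (m : ℕ) : 0 < μ.real (dyadicIoc m) :=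
  lt_of_lt_of_le (by have := Real.pi_pos; positivity) (le_μ_real_Ioc m)

theorem μ_real_preimage_dyadicIoc (m : ℕ) :
    μ.real ((fun t : ℝ => 1 - t) ⁻¹' dyadicIoc m) = μ.real (dyadicIoc m) := by
  rw [measureReal_def, measureReal_def,
    measurePreserving_one_sub.measure_preimage (measurableSet_dyadicIoc m).nullMeasurableSet]

/-- The form with the kernel `∑_m c_m 1_{A_m}(s) 1_{A_m}(1 - t)`, where `A_m` is the interval
`(4^{-m-1}, 4^{-m}]` and `c_m = (nM)^{-1/2} 2^m / μ(A_m)`. Up to constants it discretizes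
`(n ln n)^{-1/2} / (s + (1 - t))`, truncated at the scale `1/n`. -/
noncomputable def dyadicForm (n M : ℕ) : G n →ₗ[ℂ] G n →ₗ[ℂ] ℂ :=
  ∑ b : Fin M × Fin n, (((√(n * M))⁻¹ * 2 ^ (b.1 : ℕ) / μ.real (dyadicIoc b.1) : ℝ) : ℂ) •
    (integralG n (dyadicIoc b.1) b.2).smulRight
      (integralG n ((fun t => 1 - t) ⁻¹' dyadicIoc b.1) b.2)

theorem dyadicForm_apply (M : ℕ) (x y : G n) : dyadicForm n M x y =
    ∑ b : Fin M × Fin n, (((√(n * M))⁻¹ * 2 ^ (b.1 : ℕ) / μ.real (dyadicIoc b.1) : ℝ) : ℂ) *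
      integralG n (dyadicIoc b.1) b.2 x *
        integralG n ((fun t => 1 - t) ⁻¹' dyadicIoc b.1) b.2 y := by
  simp only [dyadicForm, LinearMap.sum_apply, LinearMap.smul_apply, LinearMap.smulRight_apply,
    smul_eq_mul, mul_assoc]

theorem sum_integralCoord_ν₁_dyadicIoc_le (M : ℕ) (g : L2 ν₁ n) :
    ∑ b : Fin M × Fin n, ‖integralCoord μ_le_ν₁ (dyadicIoc b.1) b.2 g‖ ^ 2 /
      ((1 / 4) ^ (b.1 : ℕ) * μ.real (dyadicIoc b.1)) ≤ ‖g‖ ^ 2 :=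
  sum_norm_sq_integralCoord_le μ_le_ν₁ (A := fun m : Fin M => dyadicIoc m)
    (K := fun m => (1 / 4) ^ (m : ℕ))
    (fun m => measurableSet_dyadicIoc m) (pairwise_disjoint_dyadicIoc M) (fun m => by positivity)
    (fun m s hs hsub => μ_le_mul_ν₁ hs fun t ht => (hsub ht).2) (fun m => μ_real_dyadicIoc_pos m) g

theorem sum_integralCoord_ν₂_dyadicIoc_le (M : ℕ) (g : L2 ν₂ n) :
    ∑ b : Fin M × Fin n, ‖integralCoord μ_le_ν₂ (dyadicIoc b.1) b.2 g‖ ^ 2 /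
      μ.real (dyadicIoc b.1) ≤ ‖g‖ ^ 2 := by
  simpa only [one_mul] using sum_norm_sq_integralCoord_le μ_le_ν₂
    (A := fun m : Fin M => dyadicIoc m) (K := fun m => 1)
    (fun m => measurableSet_dyadicIoc m) (pairwise_disjoint_dyadicIoc M) (fun m => one_pos)
    (fun m s hs hsub => by simpa using μ_le_ν₂ s) (fun m => μ_real_dyadicIoc_pos m) g

theorem sum_integralCoord_ν₁_preimage_dyadicIoc_le (M : ℕ) (g : L2 ν₁ n) :
    ∑ b : Fin M × Fin n,
      ‖integralCoord μ_le_ν₁ ((fun t => 1 - t) ⁻¹' dyadicIoc b.1) b.2 g‖ ^ 2 /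
        μ.real (dyadicIoc b.1) ≤ ‖g‖ ^ 2 := by
  simpa only [one_mul, μ_real_preimage_dyadicIoc] using sum_norm_sq_integralCoord_le μ_le_ν₁
    (A := fun m : Fin M => (fun t => 1 - t) ⁻¹' dyadicIoc m) (K := fun m => 1)
    (fun m => measurableSet_preimage_dyadicIoc m)
    (fun m m' h => (pairwise_disjoint_dyadicIoc M h).preimage _) (fun m => one_pos)
    (fun m s hs hsub => by simpa using μ_le_ν₁ s)
    (fun m => (μ_real_dyadicIoc_pos m).trans_eq (μ_real_preimage_dyadicIoc m).symm) g

theorem sum_integralCoord_ν₂_preimage_dyadicIoc_le (M : ℕ) (g : L2 ν₂ n) :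
    ∑ b : Fin M × Fin n,
      ‖integralCoord μ_le_ν₂ ((fun t => 1 - t) ⁻¹' dyadicIoc b.1) b.2 g‖ ^ 2 /
        ((1 / 4) ^ (b.1 : ℕ) * μ.real (dyadicIoc b.1)) ≤ ‖g‖ ^ 2 := by
  simpa only [μ_real_preimage_dyadicIoc] using sum_norm_sq_integralCoord_le μ_le_ν₂
    (A := fun m : Fin M => (fun t => 1 - t) ⁻¹' dyadicIoc m) (K := fun m => (1 / 4) ^ (m : ℕ))
    (fun m => measurableSet_preimage_dyadicIoc m)
    (fun m m' h => (pairwise_disjoint_dyadicIoc M h).preimage _) (fun m => by positivity)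
    (fun m s hs hsub => μ_le_mul_ν₂ hs fun t ht => (hsub ht).2)
    (fun m => (μ_real_dyadicIoc_pos m).trans_eq (μ_real_preimage_dyadicIoc m).symm) g

theorem isJointCompleteContraction_dyadicForm {M : ℕ} (hn : 1 ≤ n) (hM1 : 1 ≤ M)
    (hM : 4 ^ (M - 1) ≤ n) :
    IsJointCompleteContraction (normsG n) (normsG n) (dyadicForm n M) := by
  have hn' : (1 : ℝ) ≤ n := by exact_mod_cast hn
  have hM1' : (1 : ℝ) ≤ M := by exact_mod_cast hM1
  have hnM : 0 < (n : ℝ) * M := by positivity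
  have hw (b : Fin M × Fin n) : 0 < μ.real (dyadicIoc b.1) := μ_real_dyadicIoc_pos b.1
  have hw4 (b : Fin M × Fin n) : 0 < (1 / 4) ^ (b.1 : ℕ) * μ.real (dyadicIoc b.1) :=
    mul_pos (by positivity) (hw b)
  -- The squared coefficients of the form with respect to the normalized functionals.
  have hcoef (b : Fin M × Fin n) (r : ℝ) :
      ((√(n * M))⁻¹ * 2 ^ (b.1 : ℕ) / μ.real (dyadicIoc b.1)) ^ 2 *
        (r * (μ.real (dyadicIoc b.1) * μ.real (dyadicIoc b.1))) =
      (n * M : ℝ)⁻¹ * (4 ^ (b.1 : ℕ) * r) := by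
    have h0 := (hw b).ne'
    rw [div_pow, mul_pow, inv_pow, Real.sq_sqrt hnM.le, ← pow_mul, mul_comm (b.1 : ℕ), pow_mul,
      show ((2 : ℝ) ^ 2) = 4 by norm_num]
    field_simp
  have h41 (m : ℕ) : (4 : ℝ) ^ m * (1 / 4) ^ m = 1 := by rw [← mul_pow]; norm_num
  have hHS : ∑ _b : Fin M × Fin n, ((n : ℝ) * M)⁻¹ ≤ 1 := by
    rw [Finset.sum_const, Finset.card_univ, Fintype.card_prod, Fintype.card_fin, Fintype.card_fin,
      nsmul_eq_mul]
    push_cast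
    rw [mul_comm (M : ℝ), mul_inv_cancel₀ hnM.ne']
  refine isJointCompleteContraction_quotientNorms (l1SumNorms_nonneg _ _) (l1SumNorms_nonneg _ _)
    (isJointCompleteContraction_l1SumNorms columnNorms_nonneg rowNorms_nonneg ?_ ?_ ?_ ?_)
  · refine isJointCompleteContraction_column_column_weighted hw4 hw
      (sum_integralCoord_ν₁_dyadicIoc_le M) (sum_integralCoord_ν₁_preimage_dyadicIoc_le M)
      (c := fun b => (√(n * M))⁻¹ * 2 ^ (b.1 : ℕ) / μ.real (dyadicIoc b.1)) ?_ fun x y => ?_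
    · refine le_trans (le_of_eq (Finset.sum_congr rfl fun b _ => ?_)) hHS
      rw [mul_assoc ((1 / 4 : ℝ) ^ _), hcoef, h41, mul_one]
    · simp only [LinearMap.compl₁₂_apply, dyadicForm_apply, integralG, Submodule.mkQ_apply,
        Submodule.liftQ_apply, LinearMap.coprod_apply, LinearMap.inl_apply, map_zero, add_zero]
  · refine isJointCompleteContraction_column_row (norm_le_of_weighted hw4 hw4
      (sum_integralCoord_ν₁_dyadicIoc_le M) (sum_integralCoord_ν₂_preimage_dyadicIoc_le M)
      (c := fun b => (√(n * M))⁻¹ * 2 ^ (b.1 : ℕ) / μ.real (dyadicIoc b.1))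
      (fun b => ?_) fun x y => ?_)
    · rw [mul_mul_mul_comm, hcoef, ← mul_assoc (4 ^ _), h41, one_mul]
      refine mul_le_one₀ (inv_le_one_of_one_le₀ (one_le_mul_of_one_le_of_one_le hn' hM1'))
        (by positivity) (pow_le_one₀ (by norm_num) (by norm_num))
    · simp only [LinearMap.compl₁₂_apply, dyadicForm_apply, integralG, Submodule.mkQ_apply,
        Submodule.liftQ_apply, LinearMap.coprod_apply, LinearMap.inl_apply, LinearMap.inr_apply,
        map_zero, add_zero, zero_add]
  · refine isJointCompleteContraction_row_column_iff.2
      (isJointCompleteContraction_column_row (norm_le_of_weighted hw hw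
      (sum_integralCoord_ν₂_dyadicIoc_le M) (sum_integralCoord_ν₁_preimage_dyadicIoc_le M)
      (c := fun b => (√(n * M))⁻¹ * 2 ^ (b.1 : ℕ) / μ.real (dyadicIoc b.1))
      (fun b => ?_) fun x y => ?_))
    · rw [← one_mul (_ * μ.real _), hcoef, mul_one, inv_mul_le_iff₀ hnM, mul_one]
      have h1 : (4 : ℝ) ^ (b.1 : ℕ) ≤ 4 ^ (M - 1) :=
        pow_le_pow_right₀ (by norm_num) (by have := b.1.2; omega)
      have h2 : ((4 : ℝ) ^ (M - 1)) ≤ n := by exact_mod_cast hM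
      nlinarith
    · simp only [LinearMap.compl₁₂_apply, dyadicForm_apply, integralG, Submodule.mkQ_apply,
        Submodule.liftQ_apply, LinearMap.coprod_apply, LinearMap.inl_apply, LinearMap.inr_apply,
        map_zero, add_zero, zero_add]
  · refine isJointCompleteContraction_row_row_iff.2
      (isJointCompleteContraction_column_column_weighted hw hw4
      (sum_integralCoord_ν₂_dyadicIoc_le M) (sum_integralCoord_ν₂_preimage_dyadicIoc_le M)
      (c := fun b => (√(n * M))⁻¹ * 2 ^ (b.1 : ℕ) / μ.real (dyadicIoc b.1)) ?_ fun x y => ?_)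
    · refine le_trans (le_of_eq (Finset.sum_congr rfl fun b _ => ?_)) hHS
      rw [mul_left_comm (μ.real _), hcoef, h41, mul_one]
    · simp only [LinearMap.compl₁₂_apply, dyadicForm_apply, integralG, Submodule.mkQ_apply,
        Submodule.liftQ_apply, LinearMap.coprod_apply, LinearMap.inr_apply, map_zero, zero_add]

theorem sum_dyadicForm_f (M : ℕ) : ∑ i, dyadicForm n M (f n i) (f n i) =
    ((n * ∑ m : Fin M, (√(n * M))⁻¹ * 2 ^ (m : ℕ) * μ.real (dyadicIoc m) : ℝ) : ℂ) := by
  have h (i : Fin n) : dyadicForm n M (f n i) (f n i) =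
      ((∑ m : Fin M, (√(n * M))⁻¹ * 2 ^ (m : ℕ) * μ.real (dyadicIoc m) : ℝ) : ℂ) := by
    rw [dyadicForm_apply, Fintype.sum_prod_type]
    push_cast
    refine Finset.sum_congr rfl fun m _ => ?_
    have h0 : ((μ.real (dyadicIoc m) : ℝ) : ℂ) ≠ 0 := by
      exact_mod_cast (μ_real_dyadicIoc_pos m).ne'
    simp only [integralG_f, μ_real_preimage_dyadicIoc]
    rw [Finset.sum_eq_single i (fun k _ hk => by simp [hk]) (by simp)]
    simp only [if_true]
    field_simp
  simp only [h]
  push_cast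
  simp

theorem le_projectiveNorm_sum_f (hn : 1 ≤ n) :
    (8 * Real.pi)⁻¹ * √(n * (1 + Real.log n)) ≤
      projectiveNorm (normsG n) (normsG n) (∑ i, f n i ⊗ₜ[ℂ] f n i) := by
  obtain ⟨M, hM1, -, hM, -, hMlog⟩ := exists_dyadic_scale hn
  have hpi := Real.pi_pos
  have hn' : (1 : ℝ) ≤ n := by exact_mod_cast hn
  have hM1' : (1 : ℝ) ≤ M := by exact_mod_cast hM1
  have hnM : 0 < (n : ℝ) * M := by positivity
  refine le_trans ?_ (le_csSup (bddAbove_projectiveSet _ _ _)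
    ⟨dyadicForm n M, isJointCompleteContraction_dyadicForm hn hM1 hM, rfl⟩)
  have e : TensorProduct.lift (dyadicForm n M) (∑ i, f n i ⊗ₜ[ℂ] f n i) =
      ∑ i, dyadicForm n M (f n i) (f n i) := by
    simp only [map_sum, TensorProduct.lift.tmul]
  rw [e, sum_dyadicForm_f, Complex.norm_real]
  refine le_trans ?_ (Real.le_norm_self _)
  have h1 : √((n : ℝ) * (1 + Real.log n)) ≤ 2 * √(n * M) := by
    rw [show (2 : ℝ) = √(2 ^ 2) from (Real.sqrt_sq zero_le_two).symm,
      ← Real.sqrt_mul (by positivity)]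
    exact Real.sqrt_le_sqrt (by nlinarith)
  have h2 : ∑ _m : Fin M, (√(n * M))⁻¹ * (3 / (4 * Real.pi)) ≤
      ∑ m : Fin M, (√(n * M))⁻¹ * 2 ^ (m : ℕ) * μ.real (dyadicIoc m) := by
    refine Finset.sum_le_sum fun m _ => ?_
    rw [mul_assoc]
    refine mul_le_mul_of_nonneg_left ?_ (by positivity)
    calc 3 / (4 * Real.pi) = 2 ^ (m : ℕ) * (3 / (4 * Real.pi) * (1 / 2) ^ (m : ℕ)) := by
          have : (2 : ℝ) ^ (m : ℕ) * (1 / 2) ^ (m : ℕ) = 1 := by rw [← mul_pow]; norm_num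
          linear_combination -(3 / (4 * Real.pi)) * this
      _ ≤ _ := mul_le_mul_of_nonneg_left (le_μ_real_Ioc m) (by positivity)
  rw [Finset.sum_const, Finset.card_univ, Fintype.card_fin, nsmul_eq_mul] at h2
  have h3 : √((n : ℝ) * M) = n * (M * (√(n * M))⁻¹) := by
    have h := Real.mul_self_sqrt hnM.le
    have h' := (Real.sqrt_pos.2 hnM).ne'
    field_simp
    linarith
  calc (8 * Real.pi)⁻¹ * √(n * (1 + Real.log n)) ≤ (8 * Real.pi)⁻¹ * (2 * √(n * M)) := by gcongr
    _ ≤ (8 * Real.pi)⁻¹ * (6 * √(n * M)) := by gcongr; norm_num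
    _ = n * (M * ((√(n * M))⁻¹ * (3 / (4 * Real.pi)))) := by
        rw [show n * (M * ((√(n * M))⁻¹ * (3 / (4 * Real.pi)))) =
          n * (M * (√(n * M))⁻¹) * (3 / (4 * Real.pi)) by ring, ← h3]
        generalize √((n : ℝ) * M) = T
        field_simp
        ring
    _ ≤ _ := by gcongr

end LowerBound

end OHProj

theorem proposition5 (n : ℕ) (hn : 1 ≤ n) :
    (∀ a : Matrix (Fin n) (Fin n) ℂ,
      OHProj.projectiveNorm (OHProj.normsG n) (OHProj.normsG n)
          (∑ i, ∑ j, a i j • (OHProj.f n i ⊗ₜ[ℂ] OHProj.f n j)) ≤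
        16 * √(1 + Real.log n) * √(∑ i, ∑ j, ‖a i j‖ ^ 2)) ∧
    (8 * Real.pi)⁻¹ * √(n * (1 + Real.log n)) ≤
      OHProj.projectiveNorm (OHProj.normsG n) (OHProj.normsG n)
        (∑ i, OHProj.f n i ⊗ₜ[ℂ] OHProj.f n i) :=
  ⟨OHProj.projectiveNorm_sum_f_le hn, OHProj.le_projectiveNorm_sum_f hn⟩
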